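/- Let $N\ge 1$, let $\Omega\subset\mathbb R^N$ be a bounded domain (nonempty, open, connected), and let $H_0^1(\Omega)$ be the closure of $C_c^\infty(\Omega)$ in $H^1(\Omega)$, with $\|u\|=\left(\int_\Omega|\nabla u|^2dx\right)^{1/2}$. Let $2^*=\frac{2N}{N-2}$ if $N\ge 3$, $2^*=\infty$ if $N=1$, and let $2^*\in(1,\infty)$ be an arbitrary finite exponent if $N=2$; let $q=\frac{2^*}{2^*-1}$ be the conjugate exponent ($q=1$ if $2^*=\infty$). Let $a,b>0$ and let $f\in L^{q}(\Omega)$ be positive a.e. in $\Omega$. For $\mu>0$ consider $$-\Big(a-b\int_\Omega|\nabla u|^2dx\Big)\Delta u=\mu f\ \text{ in }\Omega,\qquad u=0\ \text{ on }\partial\Omega. \tag{P}$$ A weak solution of (P) is a $u\in H_0^1(\Omega)$ such that for all $v\in H_0^1(\Omega)$ the function $fv$ is integrable on $\Omega$ and $\left(a-b\|u\|^2\right)\int_\Omega\nabla u\cdot\nabla v\,dx=\mu\int_\Omega fv\,dx$. It is called positive if $u>0$ a.e. in $\Omega$. Put $$I(u)=\frac a2\|u\|^2-\frac b4\|u\|^4-\mu\int_\Omega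 fu\,dx,\quad S=\inf_{u\in H_0^1(\Omega)\setminus\{0\}}\frac{\|u\|^2}{\|u\|_{L^{2^*}(\Omega)}^2},\quad \mu_*=\frac{a}{18b}\,(6abS)^{1/2}\,\|f\|_{L^{q}(\Omega)}^{-1},\quad r=\Big(\frac{2a}{3b}\Big)^{1/2}.$$ Then $\mu_*>0$, and for every $\mu\in(0,\mu_*)$ problem (P) has at least two distinct positive weak solutions $u_1\ne u_2$ with the following properties. (1) $u_1$ is a local minimizer of $I$ in $H_0^1(\Omega)$ and minimizes $I$ over $\{u:\|u\|\le r\}$; moreover $I(u_1)<0$ and $\|u_1\|^2<\frac{a}{3b}$. (2) $u_2$ is a mountain-pass solution: for every $e\in H_0^1(\Omega)$ with $\|e\|>r$ and $I(e)\le 0$, $$I(u_2)=\inf_{\gamma\in\Gamma_e}\ \sup_{t\in[0,1]}I(\gamma(t)),\qquad \Gamma_e=\{\gamma\in C^1([0,1],H_0^1(\Omega)):\gamma(0)=0,\ \gamma(1)=e\};$$ moreover $0<I(u_2)<\frac{a^2}{4b}$ and $\frac{2a}{3b}<\|u_2\|^2<\frac ab$. -/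

import Mathlib

open MeasureTheory Set
open scoped ENNReal ContDiff Gradient RealInnerProductSpace

noncomputable section

namespace Kirchhoff

/-- The ambient space `L²(Ω) × L²(Ω; ℝᴺ)` with its Hilbert space norm. A function `u ∈ H¹(Ω)` is
identified with the pair `(u, ∇u)`, and the norm of the pair is then the `H¹` norm of `u`. -/
abbrev PairSpace {N : ℕ} (Ω : Set (EuclideanSpace ℝ (Fin N))) : Type :=
  WithLp 2 (Lp ℝ 2 (volume.restrict Ω) × Lp (EuclideanSpace ℝ (Fin N)) 2 (volume.restrict Ω))

/-- `φ ∈ C_c^∞(Ω)`. -/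
def IsTestFunction {N : ℕ} (Ω : Set (EuclideanSpace ℝ (Fin N)))
    (φ : EuclideanSpace ℝ (Fin N) → ℝ) : Prop :=
  ContDiff ℝ ∞ φ ∧ HasCompactSupport φ ∧ tsupport φ ⊆ Ω

/-- The subspace of all pairs `(φ, ∇φ)` with `φ ∈ C_c^∞(Ω)`. -/
def testPairs {N : ℕ} (Ω : Set (EuclideanSpace ℝ (Fin N))) : Submodule ℝ (PairSpace Ω) where
  carrier := {w | ∃ φ : EuclideanSpace ℝ (Fin N) → ℝ, IsTestFunction Ω φ ∧
    w.fst =ᵐ[volume.restrict Ω] φ ∧ w.snd =ᵐ[volume.restrict Ω] ∇ φ}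
  zero_mem' := by
    refine ⟨fun _ => 0, ⟨contDiff_const, HasCompactSupport.zero, ?_⟩, ?_, ?_⟩
    · simp [tsupport]
    · exact Lp.coeFn_zero _ _ _
    · have h : ∇ (fun _ : EuclideanSpace ℝ (Fin N) => (0 : ℝ)) = 0 := by
        ext1 x; simp [gradient]
      rw [h]
      exact Lp.coeFn_zero _ _ _
  add_mem' := by
    rintro v w ⟨φ, ⟨hφ, cφ, sφ⟩, v1, v2⟩ ⟨ψ, ⟨hψ, cψ, sψ⟩, w1, w2⟩
    refine ⟨φ + ψ, ⟨hφ.add hψ, cφ.add cψ, ?_⟩, ?_, ?_⟩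
    · exact (tsupport_add φ ψ).trans (union_subset sφ sψ)
    · exact (Lp.coeFn_add v.fst w.fst).trans (v1.add w1)
    · have h : ∇ (φ + ψ) = ∇ φ + ∇ ψ := by
        ext1 x
        have d1 := (hφ.differentiable (by simp)) x
        have d2 := (hψ.differentiable (by simp)) x
        simp [gradient, fderiv_add d1 d2]
      rw [h]
      exact (Lp.coeFn_add v.snd w.snd).trans (v2.add w2)
  smul_mem' := by
    rintro c v ⟨φ, ⟨hφ, cφ, sφ⟩, v1, v2⟩
    refine ⟨c • φ, ⟨hφ.const_smul c, cφ.smul_left (f := fun _ => c), ?_⟩, ?_, ?_⟩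
    · exact (tsupport_smul_subset_right (fun _ => c) φ).trans sφ
    · exact (Lp.coeFn_smul c v.fst).trans (v1.const_smul c)
    · have h : ∇ (c • φ) = c • ∇ φ := by
        ext1 x
        have d1 := (hφ.differentiable (by simp)) x
        simp [gradient, fderiv_const_smul d1]
      rw [h]
      exact (Lp.coeFn_smul c v.snd).trans (v2.const_smul c)

/-- The Sobolev space `H₀¹(Ω)`: the closure of `C_c^∞(Ω)` in the `H¹` norm. -/
abbrev H01 {N : ℕ} (Ω : Set (EuclideanSpace ℝ (Fin N))) : Type :=
  (testPairs Ω).topologicalClosure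

variable {N : ℕ} {Ω : Set (EuclideanSpace ℝ (Fin N))}

/-- The underlying function of `u ∈ H₀¹(Ω)`. -/
def val (u : H01 Ω) : EuclideanSpace ℝ (Fin N) → ℝ := (u : PairSpace Ω).fst

/-- The weak gradient of `u ∈ H₀¹(Ω)`. -/
def grad (u : H01 Ω) : EuclideanSpace ℝ (Fin N) → EuclideanSpace ℝ (Fin N) :=
  (u : PairSpace Ω).snd

/-- The norm `‖u‖ = (∫_Ω |∇u|²)^{1/2}`. -/
def energyNorm (u : H01 Ω) : ℝ := √(∫ x in Ω, ‖grad u x‖ ^ 2)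

/-- The admissible values of the exponent `2*`: it is `∞` for `N = 1`, any finite number greater
than `1` for `N = 2`, and `2N/(N-2)` for `N ≥ 3`. -/
def IsSobolevExponent (N : ℕ) (p : ℝ≥0∞) : Prop :=
  (N = 1 ∧ p = ⊤) ∨ (N = 2 ∧ 1 < p ∧ p < ⊤) ∨
    (3 ≤ N ∧ p = ENNReal.ofReal (2 * (N : ℝ) / ((N : ℝ) - 2)))

/-- The best Sobolev constant `S = inf_{u ≠ 0} ‖∇u‖₂² / ‖u‖_p²` on `H₀¹(Ω)`. -/
def sobolevConst (Ω : Set (EuclideanSpace ℝ (Fin N))) (p : ℝ≥0∞) : ℝ :=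
  sInf {s : ℝ | ∃ u : H01 Ω, u ≠ 0 ∧
    s = energyNorm u ^ 2 / (eLpNorm (val u) p (volume.restrict Ω)).toReal ^ 2}

/-- `μ_* = (a / (18 b)) (6 a b S)^{1/2} / ‖f‖_{p'}`, where `p' = p/(p-1)`. -/
def muStar (Ω : Set (EuclideanSpace ℝ (Fin N))) (p : ℝ≥0∞) (a b : ℝ)
    (f : EuclideanSpace ℝ (Fin N) → ℝ) : ℝ :=
  a / (18 * b) * √(6 * a * b * sobolevConst Ω p) /
    (eLpNorm f p.conjExponent (volume.restrict Ω)).toReal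

/-- `u ∈ H₀¹(Ω)` is a weak solution of `-(a - b ∫_Ω |∇u|²) Δu = μ f` in `Ω`, `u = 0` on `∂Ω`. -/
def IsWeakSolution (a b μ : ℝ) (f : EuclideanSpace ℝ (Fin N) → ℝ) (u : H01 Ω) : Prop :=
  ∀ v : H01 Ω, IntegrableOn (fun x => f x * val v x) Ω ∧
    (a - b * ∫ x in Ω, ‖grad u x‖ ^ 2) * ∫ x in Ω, ⟪grad u x, grad v x⟫ =
      μ * ∫ x in Ω, f x * val v x

/-- `u > 0` almost everywhere in `Ω`. -/
def IsPositive (u : H01 Ω) : Prop := ∀ᵐ x ∂(volume.restrict Ω), 0 < val u x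

/-- The functional `I(u) = (a/2)‖u‖² - (b/4)‖u‖⁴ - μ ∫_Ω f u`. -/
def energy (a b μ : ℝ) (f : EuclideanSpace ℝ (Fin N) → ℝ) (u : H01 Ω) : ℝ :=
  a / 2 * energyNorm u ^ 2 - b / 4 * energyNorm u ^ 4 - μ * ∫ x in Ω, f x * val u x

/-- `c = inf_{γ ∈ Γ} sup_{t ∈ [0,1]} I(γ(t))`, where `Γ` is the set of `C¹` paths `γ` on `[0,1]`
with values in `H₀¹(Ω)` from `γ(0) = 0` to `γ(1) = e`. The supremum and the infimum are required
to exist as real numbers. -/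
def IsMountainPassLevel (I : H01 Ω → ℝ) (e : H01 Ω) (c : ℝ) : Prop :=
  (∀ γ : ℝ → H01 Ω, ContDiffOn ℝ 1 γ (Icc 0 1) → BddAbove ((fun t => I (γ t)) '' Icc 0 1)) ∧
  IsGLB {m : ℝ | ∃ γ : ℝ → H01 Ω, ContDiffOn ℝ 1 γ (Icc 0 1) ∧ γ 0 = 0 ∧ γ 1 = e ∧
    m = sSup ((fun t => I (γ t)) '' Icc 0 1)} c

end Kirchhoff

end

/-!
The right-hand side does not depend on the unknown, so the nonlocal problem reduces to a scalar
equation. Let `w ∈ H₀¹(Ω)` be the weak solution of `-Δw = f`, that is, the Riesz representative of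
`v ↦ ∫ f v` for the Dirichlet inner product (`exists_weak_poisson`). Then `s w / ‖w‖` solves the
Kirchhoff equation if and only if `a s - b s³ = μ ‖w‖` (`quarticEnergy_critical`). For
`μ < muStar` this cubic equation has two positive roots `s₁ < s₂` on the two sides of
`s² = a / (3b)` (`mul_norm_lt_of_lt_muStar`, `exists_fiber_critical_points`), and they give the two
solutions.

By the Cauchy-Schwarz inequality the energy at `u` is at least the value at `‖u‖` of a quartic
polynomial, `fiberEnergy`, with equality on the ray through `w`. This polynomial decreases on
`[0, s₁]`, increases on `[s₁, s₂]` and decreases afterwards. Hence `s₁` gives a minimizer on the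
ball of radius `s₂`. The sphere of radius `s₂` separates `0` from every remote point of nonpositive
energy, and the energy on it is at least `fiberEnergy s₂`; conversely a path that follows the ray
through `w` to a remote point, turns around the origin where the energy is negative, and returns to
the endpoint along its own ray never exceeds this level (`isMountainPassLevel`). The detour uses
that `H₀¹(Ω)` is not a line.

The analytic input consists of the following.
* The Sobolev inequality (`exists_sobolev`), from the Gagliardo-Nirenberg-Sobolev inequality for
  test functions and, in dimension one, from the fundamental theorem of calculus.
* Positivity of the Sobolev constant (`sobolevConst_pos`), which also needs that a function of
  `H₀¹(Ω)` that vanishes almost everywhere has zero weak gradient (`eq_zero_of_val_ae_eq_zero`).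
* Positivity of `w` (`isPositive_of_weak`). Since `f > 0` almost everywhere, no Harnack inequality
  is needed: testing with `H(w)`, where `H ≥ 0` is nonincreasing and positive exactly on the
  negative reals, gives `w ≥ 0`, and testing with `φ² g(w)`, where `g` is a bounded substitute for
  `1 / s`, bounds `∫ f φ² g(w)` by `∫ |∇φ|²` and so excludes a zero set of positive measure.
-/

namespace Kirchhoff

open MeasureTheory Set Filter Topology

/-! ### The fibering polynomial -/

/-- The value of the energy along the ray of norm `s` in the direction of the Riesz representative
of the linear term, where `κ` is `μ` times the norm of that representative. -/
noncomputable def fiberEnergy (a b κ s : ℝ) : ℝ := a / 2 * s ^ 2 - b / 4 * s ^ 4 - κ * s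

/-- The positive critical points of `fiberEnergy a b κ`: the cubic `a s - b s³` increases up to
`s² = a / (3 b)` and decreases afterwards. -/
lemma exists_fiber_critical_points {a b κ : ℝ} (ha : 0 < a) (hb : 0 < b) (hκ : 0 < κ)
    (hκ' : κ < a / 3 * √(2 * a / (3 * b))) :
    ∃ s₁ s₂ : ℝ, 0 < s₁ ∧ s₁ < s₂ ∧ s₁ ^ 2 < a / (3 * b) ∧ 2 * a / (3 * b) < s₂ ^ 2 ∧
      s₂ ^ 2 < a / b ∧ a * s₁ - b * s₁ ^ 3 = κ ∧ a * s₂ - b * s₂ ^ 3 = κ := by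
  set r := √(2 * a / (3 * b)) with hr
  set m := √(a / (3 * b)) with hm
  set M := √(a / b) with hM
  have hr0 : 0 < r := by positivity
  have hm0 : 0 < m := by positivity
  have hr2 : b * r ^ 2 = 2 * a / 3 := by
    rw [hr, Real.sq_sqrt (by positivity)]; field_simp
  have hm2 : b * m ^ 2 = a / 3 := by
    rw [hm, Real.sq_sqrt (by positivity)]; field_simp
  have hM2 : b * M ^ 2 = a := by
    rw [hM, Real.sq_sqrt (by positivity)]; field_simp
  have hmr : m < r := Real.sqrt_lt_sqrt (by positivity) (by
    rw [mul_div_assoc]; nlinarith [show 0 < a / (3 * b) by positivity])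
  have hrM : r < M := Real.sqrt_lt_sqrt (by positivity) (by
    rw [div_lt_div_iff₀ (by positivity) hb]; nlinarith [mul_pos ha hb])
  have hrm2 : r < 2 * m := by
    rw [hr, hm, Real.sqrt_lt' (by positivity), mul_pow, Real.sq_sqrt (by positivity)]
    rw [mul_div_assoc]; nlinarith [show 0 < a / (3 * b) by positivity]
  have hc : Continuous fun s : ℝ => a * s - b * s ^ 3 := by fun_prop
  have hvm : κ < a * m - b * m ^ 3 := by
    have : a * m - b * m ^ 3 = 2 * a / 3 * m := by linear_combination -m * hm2
    rw [this]
    nlinarith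
  have hvr : κ < a * r - b * r ^ 3 := by
    have : a * r - b * r ^ 3 = a / 3 * r := by linear_combination -r * hr2
    rwa [this]
  obtain ⟨s₁, hs₁, h₁⟩ := intermediate_value_Ioo hm0.le hc.continuousOn
    (show κ ∈ Ioo _ _ from ⟨by simpa using hκ, hvm⟩)
  obtain ⟨s₂, hs₂, h₂⟩ := intermediate_value_Ioo' hrM.le hc.continuousOn
    (show κ ∈ Ioo _ _ from ⟨by
      have : a * M - b * M ^ 3 = 0 := by linear_combination -M * hM2
      simpa [this] using hκ, hvr⟩)
  refine ⟨s₁, s₂, hs₁.1, hs₁.2.trans (hmr.trans hs₂.1), ?_, ?_, ?_, h₁, h₂⟩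
  · exact (Real.lt_sqrt hs₁.1.le).1 hs₁.2
  · exact (Real.sqrt_lt' (hr0.trans hs₂.1)).1 hs₂.1
  · exact (Real.lt_sqrt (hr0.trans hs₂.1).le).1 hs₂.2

/-- At a critical point `t` the difference of the fiber energies has `(s - t)²` as a factor. -/
lemma fiberEnergy_sub_eq {a b κ t : ℝ} (ht : a * t - b * t ^ 3 = κ) (s : ℝ) :
    fiberEnergy a b κ s - fiberEnergy a b κ t =
      (s - t) ^ 2 * (a / 2 - b / 4 * (s ^ 2 + 2 * s * t + 3 * t ^ 2)) := by
  subst ht; unfold fiberEnergy; ring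

lemma fiberEnergy_critical {a b κ t : ℝ} (ht : a * t - b * t ^ 3 = κ) :
    fiberEnergy a b κ t = t ^ 2 / 4 * (3 * b * t ^ 2 - 2 * a) := by
  subst ht; unfold fiberEnergy; ring

lemma fiberEnergy_min {a b κ s₁ s₂ s : ℝ} (hb : 0 < b) (h0 : 0 < s₁) (h12 : s₁ < s₂)
    (h₁ : a * s₁ - b * s₁ ^ 3 = κ) (h₂ : a * s₂ - b * s₂ ^ 3 = κ) (hs : 0 ≤ s) (hs₂ : s ≤ s₂) :
    fiberEnergy a b κ s₁ ≤ fiberEnergy a b κ s := by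
  -- Both `s₁` and `s₂` solve the same depressed cubic.
  have hv : b * (s₁ ^ 2 + s₁ * s₂ + s₂ ^ 2) = a := by
    apply mul_left_cancel₀ (sub_pos.2 h12).ne'
    linear_combination h₁ - h₂
  have key : b * (s ^ 2 + 2 * s * s₁ + 3 * s₁ ^ 2) ≤ 2 * a := by
    have : s ^ 2 + 2 * s * s₁ + 3 * s₁ ^ 2 ≤ 2 * (s₁ ^ 2 + s₁ * s₂ + s₂ ^ 2) := by nlinarith
    nlinarith
  have := fiberEnergy_sub_eq h₁ s
  nlinarith [mul_nonneg (sq_nonneg (s - s₁))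
    (show 0 ≤ a / 2 - b / 4 * (s ^ 2 + 2 * s * s₁ + 3 * s₁ ^ 2) by linarith)]

lemma fiberEnergy_max {a b κ s₂ s : ℝ} (hb : 0 < b) (h0 : 0 < s₂)
    (hr : 2 * a / (3 * b) < s₂ ^ 2) (h₂ : a * s₂ - b * s₂ ^ 3 = κ) (hs : 0 ≤ s) :
    fiberEnergy a b κ s ≤ fiberEnergy a b κ s₂ := by
  rw [div_lt_iff₀ (by positivity)] at hr
  have key : 2 * a ≤ b * (s ^ 2 + 2 * s * s₂ + 3 * s₂ ^ 2) := by
    have : 0 ≤ b * (s ^ 2 + 2 * s * s₂) := by positivity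
    linarith
  have := fiberEnergy_sub_eq h₂ s
  nlinarith [mul_nonneg (sq_nonneg (s - s₂))
    (show 0 ≤ -(a / 2 - b / 4 * (s ^ 2 + 2 * s * s₂ + 3 * s₂ ^ 2)) by linarith)]

lemma fiberEnergy_pos {a b κ s₂ s : ℝ} (ha : 0 < a) (hb : 0 < b) (h0 : 0 < s₂)
    (hr : 2 * a / (3 * b) < s₂ ^ 2) (h₂ : a * s₂ - b * s₂ ^ 3 = κ) (hs0 : 0 < s)
    (hs : 2 * a / (3 * b) < s ^ 2) (hs₂ : s < s₂) : 0 < fiberEnergy a b κ s := by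
  rw [div_lt_iff₀ (by positivity)] at hr hs
  have h1 : κ ≤ a * s - b * s ^ 3 := by
    have : 0 ≤ (s₂ - s) * (b * (s ^ 2 + s * s₂ + s₂ ^ 2) - a) := by
      apply mul_nonneg (by linarith)
      have : 0 ≤ b * (s * s₂) := by positivity
      nlinarith
    subst h₂; linarith
  have h2 : fiberEnergy a b κ s =
      s * (a * s - b * s ^ 3 - κ) + s ^ 2 / 4 * (3 * b * s ^ 2 - 2 * a) := by
    unfold fiberEnergy; ring
  rw [h2]
  have h3 : 0 < s ^ 2 / 4 * (3 * b * s ^ 2 - 2 * a) := mul_pos (by positivity) (by linarith)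
  have h4 : 0 ≤ s * (a * s - b * s ^ 3 - κ) := mul_nonneg hs0.le (by linarith)
  linarith

/-! ### Smooth paths -/

/-- `p` and `q` are the ends of a smooth path in `s` that is constant before time `0` and after
time `1`. The constant ends make concatenations smooth. -/
def SmoothlyJoinedIn {V : Type*} [NormedAddCommGroup V] [NormedSpace ℝ V] (s : Set V) (p q : V) :
    Prop :=
  ∃ γ : ℝ → V, ContDiff ℝ 1 γ ∧ (∀ t ≤ 0, γ t = p) ∧ (∀ t, 1 ≤ t → γ t = q) ∧ ∀ t, γ t ∈ s

namespace SmoothlyJoinedIn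

variable {V : Type*} [NormedAddCommGroup V] [NormedSpace ℝ V] {s : Set V} {p q r : V}

lemma trans (h₁ : SmoothlyJoinedIn s p q) (h₂ : SmoothlyJoinedIn s q r) :
    SmoothlyJoinedIn s p r := by
  obtain ⟨γ, hγ, γ0, γ1, γs⟩ := h₁
  obtain ⟨δ, hδ, δ0, δ1, δs⟩ := h₂
  refine ⟨fun t => γ (2 * t) + δ (2 * t - 1) - q, by fun_prop, fun t ht => ?_, fun t ht => ?_,
    fun t => ?_⟩
  · simp only []
    rw [γ0 _ (by linarith), δ0 _ (by linarith)]; abel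
  · simp only []
    rw [γ1 _ (by linarith), δ1 _ (by linarith)]; abel
  · simp only []
    rcases le_total (2 * t) 1 with ht | ht
    · rw [δ0 _ (by linarith), add_sub_cancel_right]; exact γs _
    · rw [γ1 _ ht, add_sub_cancel_left]; exact δs _

lemma of_segment_subset (h : segment ℝ p q ⊆ s) : SmoothlyJoinedIn s p q := by
  refine ⟨fun t => p + Real.smoothTransition t • (q - p), ?_, fun t ht => ?_, fun t ht => ?_,
    fun t => h ?_⟩
  · exact contDiff_const.add ((Real.smoothTransition.contDiff (n := 1)).smul contDiff_const)
  · simp [Real.smoothTransition.zero_of_nonpos ht]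
  · simp [Real.smoothTransition.one_of_one_le ht]
  · rw [segment_eq_image']
    exact ⟨_, ⟨Real.smoothTransition.nonneg t, Real.smoothTransition.le_one t⟩, rfl⟩

end SmoothlyJoinedIn

lemma zero_notMem_segment {V : Type*} [AddCommGroup V] [Module ℝ V] {x y : V}
    (hy : y ≠ 0) (hx : x ∉ Submodule.span ℝ {y}) : (0 : V) ∉ segment ℝ x y := by
  rintro ⟨α, β, -, -, h1, h⟩
  rcases eq_or_ne α 0 with rfl | hα
  · have : β = 1 := by linarith
    simp [this, hy] at h
  · refine hx (Submodule.mem_span_singleton.2 ⟨-(α⁻¹ * β), ?_⟩)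
    have : x = -((α⁻¹ * β) • y) := by
      rw [eq_neg_iff_add_eq_zero, mul_smul, ← smul_right_injective V hα |>.eq_iff]
      simp [smul_smul, hα, h]
    rw [this, neg_smul]

/-- Two lines never fill a space that is not a line. -/
lemma exists_notMem_span_singletons {V : Type*} [AddCommGroup V] [Module ℝ V] {w e z : V}
    (hw : w ≠ 0) (hz : z ∉ Submodule.span ℝ {w}) :
    ∃ y, y ∉ Submodule.span ℝ {w} ∧ y ∉ Submodule.span ℝ {e} := by
  by_cases he : e ∈ Submodule.span ℝ {w}
  · exact ⟨z, hz, fun h => hz ((Submodule.span_singleton_le_iff_mem _ _).2 he h)⟩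
  · refine ⟨e + w, fun h => he ?_, fun h => he ?_⟩
    · simpa using Submodule.sub_mem _ h (Submodule.mem_span_singleton_self w)
    · have h' : w ∈ Submodule.span ℝ {e} := by
        simpa using Submodule.sub_mem _ h (Submodule.mem_span_singleton_self e)
      obtain ⟨c, rfl⟩ := Submodule.mem_span_singleton.1 h'
      have hc : c ≠ 0 := by rintro rfl; simp at hw
      exact Submodule.mem_span_singleton.2 ⟨c⁻¹, by simp [smul_smul, hc]⟩

/-! ### Critical points of the quartic energy on an abstract space -/

section QuarticEnergy

variable {V H : Type*} [NormedAddCommGroup V] [NormedSpace ℝ V] [NormedAddCommGroup H]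
  [InnerProductSpace ℝ H]

/-- The quartic energy `a/2 ‖Du‖² - b/4 ‖Du‖⁴ - μ ⟪Dw, Du⟫`. For the Kirchhoff functional `D` is
the gradient, and `w` represents the linear term `u ↦ ∫ f u`. -/
noncomputable def quarticEnergy (D : V →L[ℝ] H) (a b μ : ℝ) (w u : V) : ℝ :=
  a / 2 * ‖D u‖ ^ 2 - b / 4 * ‖D u‖ ^ 4 - μ * ⟪D w, D u⟫

variable {D : V →L[ℝ] H} {a b μ : ℝ} {w : V}

lemma fiberEnergy_le_quarticEnergy (hμ : 0 < μ) (u : V) :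
    fiberEnergy a b (μ * ‖D w‖) ‖D u‖ ≤ quarticEnergy D a b μ w u := by
  unfold fiberEnergy quarticEnergy
  nlinarith [real_inner_le_norm (D w) (D u)]

lemma quarticEnergy_ray (hw : D w ≠ 0) {s : ℝ} (hs : 0 ≤ s) :
    ‖D ((s / ‖D w‖) • w)‖ = s ∧
      quarticEnergy D a b μ w ((s / ‖D w‖) • w) = fiberEnergy a b (μ * ‖D w‖) s := by
  have hW : 0 < ‖D w‖ := norm_pos_iff.2 hw
  have h1 : ‖D ((s / ‖D w‖) • w)‖ = s := by
    rw [map_smul, norm_smul, Real.norm_of_nonneg (by positivity)]; field_simp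
  refine ⟨h1, ?_⟩
  unfold quarticEnergy fiberEnergy
  rw [h1, map_smul, real_inner_smul_right, real_inner_self_eq_norm_sq]
  field_simp

/-- A solution `s` of the scalar equation gives a solution of the Euler-Lagrange equation. -/
lemma quarticEnergy_critical (hw : D w ≠ 0) {s : ℝ} (hs : 0 ≤ s)
    (h : a * s - b * s ^ 3 = μ * ‖D w‖) (v : V) :
    (a - b * ‖D ((s / ‖D w‖) • w)‖ ^ 2) * ⟪D ((s / ‖D w‖) • w), D v⟫ = μ * ⟪D w, D v⟫ := by
  have hW : 0 < ‖D w‖ := norm_pos_iff.2 hw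
  rw [(quarticEnergy_ray (a := a) (b := b) (μ := μ) hw hs).1, map_smul, real_inner_smul_left]
  field_simp
  linear_combination ⟪D w, D v⟫ * h

lemma exists_quarticEnergy_nonpos (ha : 0 < a) (hb : 0 < b) (hμ : 0 < μ) :
    ∃ ρ : ℝ, 0 < ρ ∧ ∀ u : V, ρ ≤ ‖D u‖ → quarticEnergy D a b μ w u ≤ 0 := by
  refine ⟨1 + (2 * a + 4 * (μ * ‖D w‖)) / b, by positivity, fun u hu => ?_⟩
  set κ := μ * ‖D w‖ with hκ
  have hκ0 : 0 ≤ κ := by positivity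
  set x := ‖D u‖ with hx
  have hx1 : 1 ≤ x := le_trans (by simp; positivity) hu
  have hxb : 2 * a + 4 * κ ≤ b * x ^ 2 := by
    have h1 : (2 * a + 4 * κ) / b ≤ x := by linarith
    rw [div_le_iff₀ hb] at h1
    nlinarith
  have h2 : -(μ * ⟪D w, D u⟫) ≤ κ * x := by
    have := neg_le_of_abs_le (abs_real_inner_le_norm (D w) (D u))
    rw [hκ, mul_assoc]
    nlinarith
  unfold quarticEnergy
  have h3 : κ * x ≤ κ * x ^ 2 := mul_le_mul_of_nonneg_left (by nlinarith) hκ0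
  have h4 : (2 * a + 4 * κ) * x ^ 2 ≤ b * x ^ 2 * x ^ 2 := by gcongr
  nlinarith

/-- Beyond the norm `(2a / (3b))^{1/2}` the energy stays nonpositive along a ray once it is: the
quotient `quarticEnergy (t • e) / t` decreases for `t ≥ 1`. -/
lemma quarticEnergy_smul_nonpos (hb : 0 < b) {e : V} (he : 2 * a / (3 * b) < ‖D e‖ ^ 2)
    (hI : quarticEnergy D a b μ w e ≤ 0) {t : ℝ} (ht : 1 ≤ t) :
    quarticEnergy D a b μ w (t • e) ≤ 0 := by
  have ht0 : 0 < t := by linarith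
  rw [div_lt_iff₀ (by positivity)] at he
  unfold quarticEnergy at hI ⊢
  rw [map_smul, norm_smul, Real.norm_of_nonneg ht0.le, real_inner_smul_right]
  set x := ‖D e‖
  have key : a / 2 * (t * x) ^ 2 - b / 4 * (t * x) ^ 4 - μ * (t * ⟪D w, D e⟫) =
      t * (a / 2 * x ^ 2 - b / 4 * x ^ 4 - μ * ⟪D w, D e⟫) -
        t * (t - 1) * (x ^ 2 / 4) * (b * x ^ 2 * (t ^ 2 + t + 1) - 2 * a) := by ring
  rw [key]
  have h1 : 0 ≤ b * x ^ 2 * (t ^ 2 + t + 1) - 2 * a := by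
    have : b * x ^ 2 * 3 ≤ b * x ^ 2 * (t ^ 2 + t + 1) := by gcongr; nlinarith
    linarith
  have h2 : 0 ≤ t * (t - 1) * (x ^ 2 / 4) * (b * x ^ 2 * (t ^ 2 + t + 1) - 2 * a) :=
    mul_nonneg (mul_nonneg (mul_nonneg ht0.le (by linarith)) (by positivity)) h1
  nlinarith

/-- Far out, a segment between two points that are not collinear with the origin lies where the
energy is nonpositive. -/
lemma exists_segment_quarticEnergy_nonpos (hD : Function.Injective D) (ha : 0 < a) (hb : 0 < b)
    (hμ : 0 < μ) {x y : V} (h0 : (0 : V) ∉ segment ℝ x y) :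
    ∃ R₀ : ℝ, ∀ R ≥ R₀, segment ℝ (R • x) (R • y) ⊆ {u | quarticEnergy D a b μ w u ≤ 0} := by
  obtain ⟨ρ, hρ, hneg⟩ := exists_quarticEnergy_nonpos (D := D) (w := w) ha hb hμ
  have hcomp : IsCompact (segment ℝ x y) := by
    rw [segment_eq_image]
    exact isCompact_Icc.image (by fun_prop)
  obtain ⟨u₀, hu₀, hmin⟩ := hcomp.exists_isMinOn ⟨x, left_mem_segment ℝ x y⟩
    (f := fun u => ‖D u‖) (by fun_prop)
  have hpos : 0 < ‖D u₀‖ := by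
    rw [norm_pos_iff, ne_eq, map_eq_zero_iff D hD]
    rintro rfl
    exact h0 hu₀
  refine ⟨ρ / ‖D u₀‖, fun R hR => ?_⟩
  have hR0 : 0 < R := lt_of_lt_of_le (by positivity) hR
  rintro _ ⟨α, β, hα, hβ, hαβ, rfl⟩
  refine hneg _ ?_
  have hu : α • x + β • y ∈ segment ℝ x y := ⟨α, β, hα, hβ, hαβ, rfl⟩
  have : α • R • x + β • R • y = R • (α • x + β • y) := by
    rw [smul_add, smul_comm α, smul_comm β]
  rw [this, map_smul, norm_smul, Real.norm_of_nonneg hR0.le]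
  rw [ge_iff_le, div_le_iff₀ hpos] at hR
  exact hR.trans (by gcongr; exact hmin hu)

/-- A path from `0` to `e` along which the energy stays below its maximum on the ray through `w`:
along that ray to a remote point, then around the origin to the ray through `e`, and back to `e`
along that ray. -/
lemma smoothlyJoinedIn_quarticEnergy (hD : Function.Injective D) (ha : 0 < a) (hb : 0 < b)
    (hμ : 0 < μ) (hw : w ≠ 0) {z : V} (hz : z ∉ Submodule.span ℝ {w}) {s₂ : ℝ} (hs₂ : 0 < s₂)
    (hr : 2 * a / (3 * b) < s₂ ^ 2) (h₂ : a * s₂ - b * s₂ ^ 3 = μ * ‖D w‖) {e : V}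
    (he : 2 * a / (3 * b) < ‖D e‖ ^ 2) (hI : quarticEnergy D a b μ w e ≤ 0) :
    SmoothlyJoinedIn {u | quarticEnergy D a b μ w u ≤ fiberEnergy a b (μ * ‖D w‖) s₂} 0 e := by
  have hDw : D w ≠ 0 := by rwa [ne_eq, map_eq_zero_iff D hD]
  have hc : 0 ≤ fiberEnergy a b (μ * ‖D w‖) s₂ := by
    simpa [fiberEnergy] using fiberEnergy_max hb hs₂ hr h₂ le_rfl
  have hsub : {u | quarticEnergy D a b μ w u ≤ 0} ⊆
      {u | quarticEnergy D a b μ w u ≤ fiberEnergy a b (μ * ‖D w‖) s₂} :=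
    fun u (hu : _ ≤ _) => hu.trans hc
  have he0 : e ≠ 0 := by
    rintro rfl
    have : 0 < 2 * a / (3 * b) := by positivity
    simp at he; linarith
  obtain ⟨y, hyw, hye⟩ := exists_notMem_span_singletons (e := e) hw hz
  obtain ⟨R₁, h1⟩ := exists_segment_quarticEnergy_nonpos (w := w) hD ha hb hμ
    (zero_notMem_segment hw hyw)
  obtain ⟨R₂, h2⟩ := exists_segment_quarticEnergy_nonpos (w := w) hD ha hb hμ
    (zero_notMem_segment he0 hye)
  set R := max 1 (max R₁ R₂)
  have hR : 1 ≤ R := le_max_left _ _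
  refine (SmoothlyJoinedIn.of_segment_subset (q := R • w) ?_).trans
    ((SmoothlyJoinedIn.of_segment_subset (q := R • y) ?_).trans
    ((SmoothlyJoinedIn.of_segment_subset (q := R • e) ?_).trans
    (SmoothlyJoinedIn.of_segment_subset ?_)))
  · rw [segment_eq_image']
    rintro _ ⟨t, ht, rfl⟩
    have hW : 0 < ‖D w‖ := norm_pos_iff.2 hDw
    have hs : 0 ≤ t * R * ‖D w‖ := mul_nonneg (mul_nonneg ht.1 (by linarith)) hW.le
    have := (quarticEnergy_ray (a := a) (b := b) (μ := μ) hDw hs).2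
    rw [mul_div_cancel_right₀ _ hW.ne'] at this
    simp only [sub_zero, zero_add, smul_smul, mem_ofPred_eq, this]
    exact fiberEnergy_max hb hs₂ hr h₂ hs
  · rw [segment_symm]
    exact (h1 R (le_max_of_le_right (le_max_left _ _))).trans hsub
  · exact (h2 R (le_max_of_le_right (le_max_right _ _))).trans hsub
  · rw [segment_symm, segment_eq_image']
    rintro _ ⟨t, ht, rfl⟩
    have : e + t • (R • e - e) = (1 + t * (R - 1)) • e := by
      simp only [smul_sub, add_smul, sub_smul, mul_sub, smul_smul, one_smul, mul_one]
    simp only [this]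
    exact hsub (quarticEnergy_smul_nonpos hb he hI
      (le_add_of_nonneg_right (mul_nonneg ht.1 (by linarith))))

/-- Every path from `0` to a remote point of nonpositive energy crosses the sphere of radius `s₂`,
where the energy is at least its value at the second critical point. -/
lemma exists_fiberEnergy_le_of_path (ha : 0 < a) (hb : 0 < b) (hμ : 0 < μ) {s₂ : ℝ}
    (hs₂ : 0 < s₂) (hr : 2 * a / (3 * b) < s₂ ^ 2) (h₂ : a * s₂ - b * s₂ ^ 3 = μ * ‖D w‖) {e : V}
    (he : 2 * a / (3 * b) < ‖D e‖ ^ 2) (hI : quarticEnergy D a b μ w e ≤ 0) {γ : ℝ → V}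
    (hγ : ContinuousOn γ (Icc 0 1)) (h0 : γ 0 = 0) (h1 : γ 1 = e) :
    ∃ t ∈ Icc (0 : ℝ) 1,
      fiberEnergy a b (μ * ‖D w‖) s₂ ≤ quarticEnergy D a b μ w (γ t) := by
  have hle : s₂ ≤ ‖D e‖ := by
    by_contra! hlt
    have hpos : 0 < ‖D e‖ := by
      have h : 0 < ‖D e‖ ^ 2 := lt_trans (by positivity) he
      exact (norm_nonneg _).lt_of_ne' (sq_pos_iff.1 h)
    have := fiberEnergy_pos ha hb hs₂ hr h₂ hpos he hlt
    linarith [fiberEnergy_le_quarticEnergy (a := a) (b := b) (D := D) (w := w) hμ e]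
  obtain ⟨t, ht, hts⟩ := intermediate_value_Icc zero_le_one (f := fun t => ‖D (γ t)‖)
    (D.continuous.norm.comp_continuousOn hγ) (show s₂ ∈ Icc _ _ from ⟨by simp [h0, hs₂.le], by
      simpa [h1] using hle⟩)
  refine ⟨t, ht, ?_⟩
  have := fiberEnergy_le_quarticEnergy (a := a) (b := b) (D := D) (w := w) hμ (γ t)
  simp only [] at hts
  rwa [hts] at this

end QuarticEnergy

/-! ### Test functions and approximation in `H₀¹(Ω)` -/

section Basic

variable {N : ℕ} {Ω : Set (EuclideanSpace ℝ (Fin N))}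

/-- The inclusion `H₀¹(Ω) → L²(Ω)`. -/
noncomputable def valL (Ω : Set (EuclideanSpace ℝ (Fin N))) :
    H01 Ω →L[ℝ] Lp ℝ 2 (volume.restrict Ω) :=
  (WithLp.fstL 2 ℝ _ _).comp (testPairs Ω).topologicalClosure.subtypeL

/-- The weak gradient as a continuous linear map `H₀¹(Ω) → L²(Ω; ℝᴺ)`. -/
noncomputable def gradL (Ω : Set (EuclideanSpace ℝ (Fin N))) :
    H01 Ω →L[ℝ] Lp (EuclideanSpace ℝ (Fin N)) 2 (volume.restrict Ω) :=
  (WithLp.sndL 2 ℝ _ _).comp (testPairs Ω).topologicalClosure.subtypeL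

lemma coe_valL (u : H01 Ω) : (valL Ω u : EuclideanSpace ℝ (Fin N) → ℝ) = val u := rfl

lemma coe_gradL (u : H01 Ω) :
    (gradL Ω u : EuclideanSpace ℝ (Fin N) → EuclideanSpace ℝ (Fin N)) = grad u := rfl

lemma memLp_val (u : H01 Ω) : MemLp (val u) 2 (volume.restrict Ω) := Lp.memLp (valL Ω u)

lemma memLp_grad (u : H01 Ω) : MemLp (grad u) 2 (volume.restrict Ω) := Lp.memLp (gradL Ω u)

lemma val_add (u v : H01 Ω) : val (u + v) =ᵐ[volume.restrict Ω] val u + val v := by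
  rw [← coe_valL, map_add]; exact Lp.coeFn_add _ _

lemma val_smul (c : ℝ) (u : H01 Ω) : val (c • u) =ᵐ[volume.restrict Ω] c • val u := by
  rw [← coe_valL, map_smul]; exact Lp.coeFn_smul _ _

lemma integral_inner_grad (u v : H01 Ω) :
    ∫ x in Ω, ⟪grad u x, grad v x⟫ = ⟪gradL Ω u, gradL Ω v⟫ := (L2.inner_def _ _).symm

lemma integral_norm_grad_sq (u : H01 Ω) : ∫ x in Ω, ‖grad u x‖ ^ 2 = ‖gradL Ω u‖ ^ 2 := by
  rw [← real_inner_self_eq_norm_sq, ← integral_inner_grad]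
  simp

lemma energyNorm_eq (u : H01 Ω) : energyNorm u = ‖gradL Ω u‖ := by
  rw [energyNorm, integral_norm_grad_sq, Real.sqrt_sq (norm_nonneg _)]

lemma norm_sq_eq (u : H01 Ω) : ‖u‖ ^ 2 = ‖valL Ω u‖ ^ 2 + ‖gradL Ω u‖ ^ 2 :=
  WithLp.prod_norm_sq_eq_of_L2 (u : PairSpace Ω)

lemma norm_gradient (φ : EuclideanSpace ℝ (Fin N) → ℝ) (x : EuclideanSpace ℝ (Fin N)) :
    ‖∇ φ x‖ = ‖fderiv ℝ φ x‖ := by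
  simp [gradient]

lemma inner_gradient (φ : EuclideanSpace ℝ (Fin N) → ℝ) (x y : EuclideanSpace ℝ (Fin N)) :
    ⟪∇ φ x, y⟫ = fderiv ℝ φ x y := by
  simp [gradient]

lemma gradient_eq_of_fderiv {φ : EuclideanSpace ℝ (Fin N) → ℝ} {x g : EuclideanSpace ℝ (Fin N)}
    (h : ∀ y, fderiv ℝ φ x y = ⟪g, y⟫) : ∇ φ x = g :=
  ext_inner_right ℝ fun y => by rw [inner_gradient, h]

variable {φ : EuclideanSpace ℝ (Fin N) → ℝ}

lemma continuous_gradient (h : ContDiff ℝ ∞ φ) : Continuous (∇ φ) :=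
  (InnerProductSpace.toDual ℝ _).symm.continuous.comp (h.continuous_fderiv (by simp))

lemma IsTestFunction.hasCompactSupport_gradient (h : IsTestFunction Ω φ) :
    HasCompactSupport (∇ φ) :=
  (h.2.1.fderiv ℝ).comp_left (map_zero (InnerProductSpace.toDual ℝ _).symm)

lemma IsTestFunction.memLp (h : IsTestFunction Ω φ) (p : ℝ≥0∞) :
    MemLp φ p (volume.restrict Ω) :=
  (h.1.continuous.memLp_of_hasCompactSupport h.2.1).restrict Ω

lemma IsTestFunction.memLp_gradient (h : IsTestFunction Ω φ) (p : ℝ≥0∞) :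
    MemLp (∇ φ) p (volume.restrict Ω) :=
  ((continuous_gradient h.1).memLp_of_hasCompactSupport h.hasCompactSupport_gradient).restrict Ω

lemma IsTestFunction.mul_left (h : IsTestFunction Ω φ) {ψ : EuclideanSpace ℝ (Fin N) → ℝ}
    (hψ : ContDiff ℝ ∞ ψ) : IsTestFunction Ω (φ * ψ) :=
  ⟨h.1.mul hψ, h.2.1.mul_right, (tsupport_mul_subset_left).trans h.2.2⟩

lemma IsTestFunction.comp (h : IsTestFunction Ω φ) {g : ℝ → ℝ} (hg : ContDiff ℝ ∞ g)
    (h0 : g 0 = 0) : IsTestFunction Ω (g ∘ φ) :=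
  ⟨hg.comp h.1, h.2.1.comp_left h0,
    (closure_mono (Function.support_comp_subset h0 φ)).trans h.2.2⟩

lemma IsTestFunction.exists_H01 (h : IsTestFunction Ω φ) :
    ∃ u : H01 Ω, val u =ᵐ[volume.restrict Ω] φ ∧ grad u =ᵐ[volume.restrict Ω] ∇ φ := by
  let w : PairSpace Ω := WithLp.toLp 2 ((h.memLp 2).toLp φ, (h.memLp_gradient 2).toLp (∇ φ))
  exact ⟨⟨w, (testPairs Ω).le_topologicalClosure
    ⟨φ, h, (h.memLp 2).coeFn_toLp, (h.memLp_gradient 2).coeFn_toLp⟩⟩,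
    (h.memLp 2).coeFn_toLp, (h.memLp_gradient 2).coeFn_toLp⟩

/-- Elements of `H₀¹(Ω)` are limits of test functions, in `H¹` and almost everywhere. -/
lemma exists_seq_isTestFunction (u : H01 Ω) :
    ∃ φ : ℕ → EuclideanSpace ℝ (Fin N) → ℝ, (∀ n, IsTestFunction Ω (φ n)) ∧
      Tendsto (fun n => eLpNorm (φ n - val u) 2 (volume.restrict Ω)) atTop (𝓝 0) ∧
      Tendsto (fun n => eLpNorm (∇ (φ n) - grad u) 2 (volume.restrict Ω)) atTop (𝓝 0) ∧
      ∀ᵐ x ∂(volume.restrict Ω), Tendsto (fun n => φ n x) atTop (𝓝 (val u x)) := by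
  obtain ⟨w, hw, hlim⟩ := mem_closure_iff_seq_limit.1 u.2
  choose φ hφ h1 h2 using hw
  have l1 : Tendsto (fun n => eLpNorm (φ n - val u) 2 (volume.restrict Ω)) atTop (𝓝 0) := by
    have := (Lp.tendsto_Lp_iff_tendsto_eLpNorm' _ _).1
      (((WithLp.fstL 2 ℝ _ _).continuous.tendsto _).comp hlim)
    refine this.congr fun n => eLpNorm_congr_ae ?_
    exact (h1 n).sub (EventuallyEq.refl _ _)
  have l2 : Tendsto (fun n => eLpNorm (∇ (φ n) - grad u) 2 (volume.restrict Ω)) atTop (𝓝 0) := by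
    have := (Lp.tendsto_Lp_iff_tendsto_eLpNorm' _ _).1
      (((WithLp.sndL 2 ℝ _ _).continuous.tendsto _).comp hlim)
    refine this.congr fun n => eLpNorm_congr_ae ?_
    exact (h2 n).sub (EventuallyEq.refl _ _)
  obtain ⟨ns, hns, hae⟩ := (tendstoInMeasure_of_tendsto_eLpNorm two_ne_zero
    (fun n => ((hφ n).memLp 2).1) (memLp_val u).1 l1).exists_seq_tendsto_ae
  exact ⟨fun n => φ (ns n), fun n => hφ _, l1.comp hns.tendsto_atTop, l2.comp hns.tendsto_atTop,
    hae⟩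

/-- `H¹` limits of test functions belong to `H₀¹(Ω)`. -/
lemma exists_H01_of_tendsto {φ : ℕ → EuclideanSpace ℝ (Fin N) → ℝ}
    (hφ : ∀ n, IsTestFunction Ω (φ n)) {g : EuclideanSpace ℝ (Fin N) → ℝ}
    {G : EuclideanSpace ℝ (Fin N) → EuclideanSpace ℝ (Fin N)}
    (hg : MemLp g 2 (volume.restrict Ω)) (hG : MemLp G 2 (volume.restrict Ω))
    (l1 : Tendsto (fun n => eLpNorm (φ n - g) 2 (volume.restrict Ω)) atTop (𝓝 0))
    (l2 : Tendsto (fun n => eLpNorm (∇ (φ n) - G) 2 (volume.restrict Ω)) atTop (𝓝 0)) :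
    ∃ u : H01 Ω, val u =ᵐ[volume.restrict Ω] g ∧ grad u =ᵐ[volume.restrict Ω] G := by
  let w : PairSpace Ω := WithLp.toLp 2 (hg.toLp g, hG.toLp G)
  refine ⟨⟨w, ?_⟩, hg.coeFn_toLp, hG.coeFn_toLp⟩
  have m1 := (Lp.tendsto_Lp_iff_tendsto_eLpNorm'' φ (fun n => (hφ n).memLp 2) g hg).2 l1
  have m2 := (Lp.tendsto_Lp_iff_tendsto_eLpNorm'' (fun n => ∇ (φ n))
    (fun n => (hφ n).memLp_gradient 2) G hG).2 l2
  refine mem_closure_of_tendsto (f := fun n => (WithLp.toLp 2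
    (((hφ n).memLp 2).toLp (φ n), ((hφ n).memLp_gradient 2).toLp (∇ (φ n))) : PairSpace Ω))
    (((WithLp.prod_continuous_toLp 2 _ _).tendsto _).comp (m1.prodMk_nhds m2)) ?_
  exact Eventually.of_forall fun n => ⟨φ n, hφ n, ((hφ n).memLp 2).coeFn_toLp,
    ((hφ n).memLp_gradient 2).coeFn_toLp⟩

/-- A function of `H₀¹(Ω)` that vanishes has zero weak gradient: the weak derivatives satisfy the
integration by parts formula, which determines them. -/
lemma eq_zero_of_val_ae_eq_zero (hΩ : IsOpen Ω) {u : H01 Ω}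
    (hu : val u =ᵐ[volume.restrict Ω] 0) : u = 0 := by
  have hparts : ∀ (i : Fin N) (ψ : EuclideanSpace ℝ (Fin N) → ℝ), IsTestFunction Ω ψ →
      ∫ x in Ω, ψ x * grad u x i = 0 := by
    intro i ψ hψ
    set e := EuclideanSpace.single i (1 : ℝ)
    have hc1 : HasCompactSupport fun x => ψ x • e := hψ.2.1.smul_right (f' := fun _ => e)
    have hm1 : MemLp (fun x => ψ x • e) 2 (volume.restrict Ω) :=
      ((hψ.1.continuous.smul continuous_const).memLp_of_hasCompactSupport hc1).restrict Ω
    have hc2 : HasCompactSupport fun x => fderiv ℝ ψ x e :=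
      (hψ.2.1.fderiv ℝ).comp_left (g := fun L : StrongDual ℝ _ => L e) rfl
    have hk2 : Continuous fun x => fderiv ℝ ψ x e :=
      (hψ.1.continuous_fderiv (by simp)).clm_apply continuous_const
    have hm2 : MemLp (fun x => fderiv ℝ ψ x e) 2 (volume.restrict Ω) :=
      (hk2.memLp_of_hasCompactSupport hc2).restrict Ω
    -- The identity `∫ ψ ∂ᵢu + ∫ u ∂ᵢψ = 0` passes from test functions to their limits.
    have hclosed : ∀ w ∈ (testPairs Ω).topologicalClosure,
        ⟪hm1.toLp _, w.snd⟫ + ⟪hm2.toLp _, w.fst⟫ = 0 := by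
      intro w hw
      refine closure_minimal (s := (testPairs Ω : Set (PairSpace Ω)))
        (t := {w | ⟪hm1.toLp _, w.snd⟫ + ⟪hm2.toLp _, w.fst⟫ = 0}) ?_ ?_ hw
      · rintro w ⟨φ, hφ, w1, w2⟩
        simp only [mem_ofPred_eq, L2.inner_def]
        have e1 : ∫ x in Ω, ⟪hm1.toLp _ x, w.snd x⟫ = ∫ x, ψ x * fderiv ℝ φ x e := by
          refine Eq.trans (b := ∫ x in Ω, ψ x * fderiv ℝ φ x e) (integral_congr_ae ?_)
            (setIntegral_eq_integral_of_forall_compl_eq_zero fun x hx => ?_)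
          · filter_upwards [hm1.coeFn_toLp, w2] with x h1 h2
            rw [h1, h2, real_inner_smul_left, real_inner_comm, inner_gradient]
          · rw [image_eq_zero_of_notMem_tsupport fun h => hx (hψ.2.2 h), zero_mul]
        have e2 : ∫ x in Ω, ⟪hm2.toLp _ x, w.fst x⟫ = ∫ x, fderiv ℝ ψ x e * φ x := by
          refine Eq.trans (b := ∫ x in Ω, fderiv ℝ ψ x e * φ x) (integral_congr_ae ?_)
            (setIntegral_eq_integral_of_forall_compl_eq_zero fun x hx => ?_)
          · filter_upwards [hm2.coeFn_toLp, w1] with x h1 h2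
            rw [h1, h2]; simp [mul_comm]
          · rw [image_eq_zero_of_notMem_tsupport fun h => hx (hφ.2.2 h), mul_zero]
        rw [e1, e2, integral_mul_fderiv_eq_neg_fderiv_mul_of_integrable, neg_add_cancel]
        · exact (hk2.mul hφ.1.continuous).integrable_of_hasCompactSupport hc2.mul_right
        · exact (hψ.1.continuous.mul ((hφ.1.continuous_fderiv (by simp)).clm_apply
            continuous_const)).integrable_of_hasCompactSupport hψ.2.1.mul_right
        · exact (hψ.1.continuous.mul hφ.1.continuous).integrable_of_hasCompactSupport
            hψ.2.1.mul_right
        · exact fun x _ => hψ.1.differentiable (by simp) x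
        · exact fun x _ => hφ.1.differentiable (by simp) x
      · refine isClosed_eq ?_ continuous_const
        have c1 := (WithLp.fstL 2 ℝ (Lp ℝ 2 (volume.restrict Ω))
          (Lp (EuclideanSpace ℝ (Fin N)) 2 (volume.restrict Ω))).continuous
        have c2 := (WithLp.sndL 2 ℝ (Lp ℝ 2 (volume.restrict Ω))
          (Lp (EuclideanSpace ℝ (Fin N)) 2 (volume.restrict Ω))).continuous
        exact (continuous_const.inner c2).add (continuous_const.inner c1)
    have h := hclosed u u.2
    have hz : (u : PairSpace Ω).fst = 0 := by
      apply Lp.ext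
      exact hu.trans (Lp.coeFn_zero _ _ _).symm
    rw [hz, inner_zero_right, add_zero, L2.inner_def] at h
    rw [← h]
    refine integral_congr_ae ?_
    filter_upwards [hm1.coeFn_toLp] with x h1
    rw [h1, real_inner_smul_left]
    simp [e, EuclideanSpace.inner_single_left, grad]
  have hgrad : gradL Ω u = 0 := by
    apply Lp.ext
    refine EventuallyEq.trans ?_ (Lp.coeFn_zero _ _ _).symm
    have hi : ∀ i : Fin N, ∀ᵐ x ∂(volume.restrict Ω), grad u x i = 0 := by
      intro i
      have hm : MemLp (fun x => grad u x i) 2 (volume.restrict Ω) :=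
        (EuclideanSpace.proj (𝕜 := ℝ) i).comp_memLp' (memLp_grad u)
      rw [ae_restrict_iff' hΩ.measurableSet]
      refine hΩ.ae_eq_zero_of_integral_contDiff_smul_eq_zero ?_ ?_
      · have h1 : LocallyIntegrable (fun x => grad u x i) (volume.restrict Ω) :=
          hm.locallyIntegrable (by norm_num)
        exact locallyIntegrableOn_of_locallyIntegrable_restrict h1
      · intro ψ h1 h2 h3
        rw [← hparts i ψ ⟨h1, h2, h3⟩]
        refine (setIntegral_eq_integral_of_forall_compl_eq_zero fun x hx => ?_).symm
        simp [image_eq_zero_of_notMem_tsupport fun h => hx (h3 h)]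
    filter_upwards [ae_all_iff.2 hi] with x hx
    ext i
    exact hx i
  have hval : valL Ω u = 0 := by
    apply Lp.ext
    exact hu.trans (Lp.coeFn_zero _ _ _).symm
  have := norm_sq_eq u
  rw [hgrad, hval] at this
  simpa using this

end Basic

/-! ### The Sobolev and Poincaré inequalities -/

section Sobolev

variable {N : ℕ} {Ω : Set (EuclideanSpace ℝ (Fin N))} {p : ℝ≥0∞}

lemma IsTestFunction.eLpNorm_restrict {φ : EuclideanSpace ℝ (Fin N) → ℝ}
    (h : IsTestFunction Ω φ) (p : ℝ≥0∞) :
    eLpNorm φ p (volume.restrict Ω) = eLpNorm φ p volume :=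
  eLpNorm_restrict_eq_of_support_subset ((subset_tsupport φ).trans h.2.2)

lemma IsTestFunction.eLpNorm_fderiv {φ : EuclideanSpace ℝ (Fin N) → ℝ}
    (h : IsTestFunction Ω φ) (p : ℝ≥0∞) :
    eLpNorm (fderiv ℝ φ) p volume = eLpNorm (∇ φ) p (volume.restrict Ω) := by
  rw [← eLpNorm_restrict_eq_of_support_subset (f := fderiv ℝ φ)
    ((support_fderiv_subset ℝ).trans h.2.2)]
  exact eLpNorm_congr_norm_ae (Eventually.of_forall fun x => (norm_gradient φ x).symm)

/-- On a bounded domain a lower integrability exponent is controlled by a higher one. -/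
lemma exists_eLpNorm_le_of_exponent_le (hΩb : Bornology.IsBounded Ω) {E : Type*}
    [NormedAddCommGroup E] {p q : ℝ≥0∞} (hp : 1 ≤ p) (hpq : p ≤ q) :
    ∃ C : ℝ≥0∞, C ≠ ⊤ ∧ ∀ g : EuclideanSpace ℝ (Fin N) → E,
      AEStronglyMeasurable g (volume.restrict Ω) →
      eLpNorm g p (volume.restrict Ω) ≤ C * eLpNorm g q (volume.restrict Ω) := by
  refine ⟨volume.restrict Ω Set.univ ^ (1 / p.toReal - 1 / q.toReal), ?_, fun g hg => ?_⟩
  · rw [Measure.restrict_apply_univ]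
    refine ENNReal.rpow_ne_top_of_nonneg ?_ hΩb.measure_lt_top.ne
    rw [sub_nonneg]
    rcases eq_or_ne q ⊤ with rfl | hq
    · simp
    · have hp0 : 0 < p.toReal :=
        ENNReal.toReal_pos (zero_lt_one.trans_le hp).ne' (ne_top_of_le_ne_top hq hpq)
      exact one_div_le_one_div_of_le hp0 (ENNReal.toReal_mono hq hpq)
  · rw [mul_comm]
    exact eLpNorm_le_eLpNorm_mul_rpow_measure_univ hpq hg

lemma exists_test_sobolev_one {Ω : Set (EuclideanSpace ℝ (Fin 1))}
    (hΩb : Bornology.IsBounded Ω) :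
    ∃ C : ℝ≥0∞, C ≠ ⊤ ∧ ∀ φ, IsTestFunction Ω φ →
      eLpNorm φ ⊤ (volume.restrict Ω) ≤ C * eLpNorm (∇ φ) 2 (volume.restrict Ω) := by
  obtain ⟨C, hC, h⟩ := exists_eLpNorm_le_of_exponent_le (E := EuclideanSpace ℝ (Fin 1)) hΩb
    le_rfl one_le_two
  refine ⟨C, hC, fun φ hφ => ?_⟩
  refine le_trans ?_ (h (∇ φ) (hφ.memLp_gradient 2).1)
  rw [← hφ.eLpNorm_fderiv, hφ.eLpNorm_restrict, eLpNorm_exponent_top]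
  refine eLpNormEssSup_le_of_ae_enorm_bound (Eventually.of_forall fun x => ?_)
  let L : ℝ ≃ₗᵢ[ℝ] EuclideanSpace ℝ (Fin 1) := (OrthonormalBasis.singleton (Fin 1) ℝ).repr
  have hd : ∀ t, ‖deriv (φ ∘ L) t‖ₑ ≤ ‖fderiv ℝ φ (L t)‖ₑ := by
    intro t
    have h1 : HasDerivAt (φ ∘ L) (fderiv ℝ φ (L t) (L 1)) t :=
      ((hφ.1.differentiable (by simp)) (L t)).hasFDerivAt.comp_hasDerivAt t
        (L.toContinuousLinearEquiv : ℝ →L[ℝ] EuclideanSpace ℝ (Fin 1)).hasDerivAt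
    rw [h1.deriv]
    refine enorm_le_iff_norm_le.2 (((fderiv ℝ φ (L t)).le_opNorm _).trans ?_)
    simp
  have h1 : ‖(φ ∘ L) (L.symm x)‖ₑ ≤ ∫⁻ t in Iic (L.symm x), ‖deriv (φ ∘ L) t‖ₑ :=
    HasCompactSupport.enorm_le_lintegral_Ici_deriv
      ((hφ.1.of_le (by simp)).comp L.contDiff)
      (hφ.2.1.comp_homeomorph L.toHomeomorph) _
  calc ‖φ x‖ₑ = ‖(φ ∘ L) (L.symm x)‖ₑ := by simp
    _ ≤ ∫⁻ t, ‖deriv (φ ∘ L) t‖ₑ := h1.trans (setLIntegral_le_lintegral _ _)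
    _ ≤ ∫⁻ t, ‖fderiv ℝ φ (L t)‖ₑ := lintegral_mono hd
    _ = ∫⁻ y, ‖fderiv ℝ φ y‖ₑ :=
        L.measurePreserving.lintegral_comp_emb L.toHomeomorph.measurableEmbedding
          (fun y => ‖fderiv ℝ φ y‖ₑ)
    _ = eLpNorm (fderiv ℝ φ) 1 volume := eLpNorm_one_eq_lintegral_enorm.symm

/-- The Sobolev inequality for test functions. In the plane the exponent `2` of the gradient is
critical, so the Gagliardo-Nirenberg-Sobolev inequality is applied with a lower one. -/
lemma exists_test_sobolev (hΩb : Bornology.IsBounded Ω) (hp : IsSobolevExponent N p) :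
    ∃ C : ℝ≥0∞, C ≠ ⊤ ∧ ∀ φ, IsTestFunction Ω φ →
      eLpNorm φ p (volume.restrict Ω) ≤ C * eLpNorm (∇ φ) 2 (volume.restrict Ω) := by
  rcases hp with ⟨rfl, rfl⟩ | ⟨rfl, h1, h2⟩ | ⟨hN, rfl⟩
  · exact exists_test_sobolev_one hΩb
  · lift p to NNReal using h2.ne
    have hq0 : 0 < p := by
      have : (1 : NNReal) < p := by exact_mod_cast h1
      exact zero_lt_one.trans this
    set m : NNReal := max p 2 with hm
    have hm2 : 2 ≤ m := le_max_right _ _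
    have hm0 : 0 < m := lt_of_lt_of_le two_pos hm2
    have hmr : (2 : ℝ) ≤ m := by exact_mod_cast hm2
    -- The exponent whose Sobolev conjugate in the plane is `m`.
    set s : NNReal := 2 * m / (m + 2) with hs
    have hs1 : 1 ≤ s := by
      rw [hs, ← NNReal.coe_le_coe]; push_cast
      rw [le_div_iff₀ (by positivity)]; linarith
    have hs2 : s < 2 := by
      rw [hs, ← NNReal.coe_lt_coe]; push_cast
      rw [div_lt_iff₀ (by positivity)]; linarith
    obtain ⟨C, hC, h⟩ := exists_eLpNorm_le_of_exponent_le (E := EuclideanSpace ℝ (Fin 2)) hΩb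
      (p := s) (q := 2) (by exact_mod_cast hs1) (by exact_mod_cast hs2.le)
    refine ⟨eLpNormLESNormFDerivOfLeConst ℝ volume Ω s p * C,
      ENNReal.mul_ne_top ENNReal.coe_ne_top hC, fun φ hφ => ?_⟩
    rw [hφ.eLpNorm_restrict, mul_assoc]
    refine (eLpNorm_le_eLpNorm_fderiv_of_le volume (hφ.1.of_le (by simp))
      ((subset_tsupport φ).trans hφ.2.2) hs1 (by simpa using hs2) ?_ hΩb).trans ?_
    · simp only [finrank_euclideanSpace, Fintype.card_fin, NNReal.coe_inv]
      have h3 : (s : ℝ)⁻¹ - ((2 : ℕ) : ℝ)⁻¹ = (m : ℝ)⁻¹ := by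
        rw [hs]; push_cast; field_simp; ring
      rw [h3]
      exact inv_anti₀ (by exact_mod_cast hq0) (by exact_mod_cast le_max_left p 2)
    · rw [hφ.eLpNorm_fderiv]
      gcongr
      exact h (∇ φ) (hφ.memLp_gradient 2).1
  · have hN' : (3 : ℝ) ≤ N := by exact_mod_cast hN
    set q : NNReal := (2 * (N : ℝ) / ((N : ℝ) - 2)).toNNReal with hq
    refine ⟨SNormLESNormFDerivOfEqConst ℝ (volume : Measure (EuclideanSpace ℝ (Fin N))) 2,
      ENNReal.coe_ne_top, fun φ hφ => ?_⟩
    rw [hφ.eLpNorm_restrict]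
    refine (eLpNorm_le_eLpNorm_fderiv_of_eq volume (p := 2) (p' := q) (hφ.1.of_le (by simp))
      hφ.2.1 one_le_two (by simp; omega) ?_).trans ?_
    · rw [hq, Real.coe_toNNReal _ (div_nonneg (by linarith) (by linarith))]
      have : (N : ℝ) - 2 ≠ 0 := by linarith
      simp only [finrank_euclideanSpace, Fintype.card_fin]
      push_cast
      field_simp
    · rw [← hφ.eLpNorm_fderiv]
      rfl

lemma IsSobolevExponent.one_le (hp : IsSobolevExponent N p) : 1 ≤ p := by
  rcases hp with ⟨rfl, rfl⟩ | ⟨rfl, h1, h2⟩ | ⟨hN, rfl⟩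
  · simp
  · exact h1.le
  · have hN' : (3 : ℝ) ≤ N := by exact_mod_cast hN
    rw [← ENNReal.ofReal_one]
    refine ENNReal.ofReal_le_ofReal ?_
    rw [le_div_iff₀ (by linarith)]; linarith

lemma exists_two_le_isSobolevExponent (hN : 1 ≤ N) : ∃ p, IsSobolevExponent N p ∧ 2 ≤ p := by
  rcases hN.eq_or_lt with rfl | hN
  · exact ⟨⊤, Or.inl ⟨rfl, rfl⟩, le_top⟩
  rcases (show 2 ≤ N from hN).eq_or_lt with rfl | hN
  · exact ⟨2, Or.inr (Or.inl ⟨rfl, by norm_num, by simp⟩), le_rfl⟩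
  · refine ⟨_, Or.inr (Or.inr ⟨hN, rfl⟩), ?_⟩
    have hN' : (3 : ℝ) ≤ N := by exact_mod_cast hN
    rw [← ENNReal.ofReal_ofNat]
    refine ENNReal.ofReal_le_ofReal ?_
    rw [le_div_iff₀ (by linarith)]; linarith

/-- An inequality between a Lebesgue norm of the function and the norm of the gradient passes from
test functions to `H₀¹(Ω)`, by Fatou's lemma. -/
lemma eLpNorm_val_le {C : ℝ≥0∞} (hC : C ≠ ⊤) (h : ∀ φ, IsTestFunction Ω φ →
      eLpNorm φ p (volume.restrict Ω) ≤ C * eLpNorm (∇ φ) 2 (volume.restrict Ω)) (u : H01 Ω) :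
    eLpNorm (val u) p (volume.restrict Ω) ≤ C * ENNReal.ofReal ‖gradL Ω u‖ := by
  obtain ⟨φ, hφ, -, l2, hae⟩ := exists_seq_isTestFunction u
  have hu : eLpNorm (grad u) 2 (volume.restrict Ω) = ENNReal.ofReal ‖gradL Ω u‖ := by
    rw [Lp.norm_def, coe_gradL, ENNReal.ofReal_toReal (memLp_grad u).2.ne]
  have hbound : ∀ n, eLpNorm (φ n) p (volume.restrict Ω) ≤
      C * (eLpNorm (∇ (φ n) - grad u) 2 (volume.restrict Ω) +
        eLpNorm (grad u) 2 (volume.restrict Ω)) := by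
    intro n
    refine (h _ (hφ n)).trans (mul_le_mul_right ?_ C)
    have := eLpNorm_add_le (((hφ n).memLp_gradient 2).1.sub (memLp_grad u).1) (memLp_grad u).1
      (p := 2) one_le_two
    simpa using this
  rw [← hu]
  refine (Lp.eLpNorm_lim_le_liminf_eLpNorm (fun n => ((hφ n).memLp p).1) _ hae).trans ?_
  have hlim : Tendsto (fun n => C * (eLpNorm (∇ (φ n) - grad u) 2 (volume.restrict Ω) +
      eLpNorm (grad u) 2 (volume.restrict Ω))) atTop
      (𝓝 (C * eLpNorm (grad u) 2 (volume.restrict Ω))) := by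
    have := ENNReal.Tendsto.const_mul (a := C)
      (l2.add (tendsto_const_nhds (x := eLpNorm (grad u) 2 (volume.restrict Ω)))) (Or.inr hC)
    simpa using this
  rw [← hlim.liminf_eq]
  exact liminf_le_liminf (Eventually.of_forall hbound)

lemma exists_sobolev (hΩb : Bornology.IsBounded Ω) (hp : IsSobolevExponent N p) :
    ∃ C : ℝ, 0 < C ∧ ∀ u : H01 Ω, MemLp (val u) p (volume.restrict Ω) ∧
      (eLpNorm (val u) p (volume.restrict Ω)).toReal ≤ C * ‖gradL Ω u‖ := by
  obtain ⟨C, hC, h⟩ := exists_test_sobolev hΩb hp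
  refine ⟨C.toReal + 1, by positivity, fun u => ?_⟩
  have hu := eLpNorm_val_le hC h u
  have hfin : C * ENNReal.ofReal ‖gradL Ω u‖ ≠ ⊤ := ENNReal.mul_ne_top hC ENNReal.ofReal_ne_top
  refine ⟨⟨(memLp_val u).1, hu.trans_lt hfin.lt_top⟩, ?_⟩
  have := ENNReal.toReal_mono hfin hu
  rw [ENNReal.toReal_mul, ENNReal.toReal_ofReal (norm_nonneg _)] at this
  nlinarith [norm_nonneg (gradL Ω u)]

/-- The Poincaré inequality, from the Sobolev inequality for some exponent `p ≥ 2`. -/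
lemma exists_poincare (hN : 1 ≤ N) (hΩb : Bornology.IsBounded Ω) :
    ∃ C : ℝ, 0 < C ∧ ∀ u : H01 Ω, ‖u‖ ≤ C * ‖gradL Ω u‖ := by
  obtain ⟨p, hp, hp2⟩ := exists_two_le_isSobolevExponent hN
  obtain ⟨C, hC, h⟩ := exists_sobolev hΩb hp
  obtain ⟨K, hK, hKq⟩ := exists_eLpNorm_le_of_exponent_le (E := ℝ) hΩb one_le_two hp2
  refine ⟨K.toReal * C + 1, by positivity, fun u => ?_⟩
  have h1 : ‖valL Ω u‖ ≤ K.toReal * C * ‖gradL Ω u‖ := by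
    have := ENNReal.toReal_mono (ENNReal.mul_ne_top hK (h u).1.2.ne) (hKq _ (memLp_val u).1)
    rw [ENNReal.toReal_mul] at this
    rw [Lp.norm_def, coe_valL, mul_assoc]
    exact this.trans (mul_le_mul_of_nonneg_left (h u).2 ENNReal.toReal_nonneg)
  have h2 := norm_sq_eq u
  have h3 : ‖u‖ ≤ ‖valL Ω u‖ + ‖gradL Ω u‖ := by
    refine abs_le_of_sq_le_sq' ?_ (by positivity) |>.2
    nlinarith [norm_nonneg (valL Ω u), norm_nonneg (gradL Ω u),
      mul_nonneg (norm_nonneg (valL Ω u)) (norm_nonneg (gradL Ω u))]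
  linarith

lemma gradL_injective (hN : 1 ≤ N) (hΩb : Bornology.IsBounded Ω) :
    Function.Injective (gradL Ω) := by
  obtain ⟨C, -, h⟩ := exists_poincare hN hΩb
  refine (injective_iff_map_eq_zero _).2 fun u hu => ?_
  simpa [hu] using h u

end Sobolev

/-! ### Nonlinear test functions -/

section Nonlinear

variable {N : ℕ} {Ω : Set (EuclideanSpace ℝ (Fin N))}

lemma tendsto_eLpNorm_two_zero_of_dominated {α E : Type*} [MeasurableSpace α] {ν : Measure α}
    [NormedAddCommGroup E] {F : ℕ → α → E} {B : α → ℝ} (hF : ∀ n, AEStronglyMeasurable (F n) ν)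
    (hB : MemLp B 2 ν) (hle : ∀ n, ∀ᵐ x ∂ν, ‖F n x‖ ≤ B x)
    (hlim : ∀ᵐ x ∂ν, Tendsto (fun n => F n x) atTop (𝓝 0)) :
    Tendsto (fun n => eLpNorm (F n) 2 ν) atTop (𝓝 0) := by
  have h2 : Tendsto (fun n => ∫⁻ x, ‖F n x‖ₑ ^ (2 : ℝ) ∂ν) atTop (𝓝 (∫⁻ _, 0 ∂ν)) := by
    refine tendsto_lintegral_of_dominated_convergence' (fun x => ‖B x‖ₑ ^ (2 : ℝ))
      (fun n => (hF n).enorm.pow_const _) (fun n => ?_) ?_ ?_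
    · filter_upwards [hle n] with x hx
      gcongr
      exact enorm_le_iff_norm_le.2 (hx.trans (le_abs_self _))
    · have := hB.2
      rw [eLpNorm_lt_top_iff_lintegral_rpow_enorm_lt_top two_ne_zero (by simp)] at this
      simpa using this.ne
    · filter_upwards [hlim] with x hx
      have := (ENNReal.continuous_rpow_const (y := 2)).tendsto _ |>.comp
        ((continuous_enorm.tendsto _).comp hx)
      simpa [Function.comp_def] using this
  have h3 := (ENNReal.continuous_rpow_const (y := 1 / 2)).tendsto _ |>.comp h2
  simp only [lintegral_zero] at h3
  rw [ENNReal.zero_rpow_of_pos (by norm_num)] at h3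
  refine h3.congr fun n => ?_
  rw [eLpNorm_eq_lintegral_rpow_enorm_toReal two_ne_zero (by simp)]
  simp

/-- Convergence in `L²` of combinations with bounded coefficients that converge almost everywhere.
The error is the sum of a dominated part and of a bounded multiple of `Y n - Y₀`. -/
lemma tendsto_eLpNorm_smul_add_smul {S E : Type*} [MeasurableSpace S] {ν : Measure S}
    [IsFiniteMeasure ν] [NormedAddCommGroup E] [NormedSpace ℝ E] {A : ℝ} {α β : ℕ → S → ℝ}
    {α₀ β₀ : S → ℝ} {X Y₀ : S → E} {Y : ℕ → S → E}
    (mα : ∀ n, AEStronglyMeasurable (α n) ν) (mα₀ : AEStronglyMeasurable α₀ ν)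
    (mβ : ∀ n, AEStronglyMeasurable (β n) ν) (mβ₀ : AEStronglyMeasurable β₀ ν)
    (mX : AEStronglyMeasurable X ν) (mY₀ : MemLp Y₀ 2 ν) (mY : ∀ n, AEStronglyMeasurable (Y n) ν)
    (hα : ∀ n x, |α n x| ≤ A) (hα₀ : ∀ x, |α₀ x| ≤ A) (hβ : ∀ n x, |β n x| ≤ A)
    (hβ₀ : ∀ x, |β₀ x| ≤ A) (hX : ∀ x, ‖X x‖ ≤ A)
    (lα : ∀ᵐ x ∂ν, Tendsto (fun n => α n x) atTop (𝓝 (α₀ x)))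
    (lβ : ∀ᵐ x ∂ν, Tendsto (fun n => β n x) atTop (𝓝 (β₀ x)))
    (lY : Tendsto (fun n => eLpNorm (Y n - Y₀) 2 ν) atTop (𝓝 0)) :
    Tendsto (fun n => eLpNorm ((fun x => α n x • X x + β n x • Y n x) -
      fun x => α₀ x • X x + β₀ x • Y₀ x) 2 ν) atTop (𝓝 0) := by
  rcases isEmpty_or_nonempty S with hS | ⟨⟨x₀⟩⟩
  · simp [Measure.eq_zero_of_isEmpty ν]
  have hA : 0 ≤ A := (abs_nonneg _).trans (hα₀ x₀)
  set F : ℕ → S → E := fun n x => (α n x - α₀ x) • X x + (β n x - β₀ x) • Y₀ x with hF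
  set G : ℕ → S → E := fun n x => β n x • (Y n x - Y₀ x) with hG
  have mF n : AEStronglyMeasurable (F n) ν :=
    (((mα n).sub mα₀).smul mX).add (((mβ n).sub mβ₀).smul mY₀.1)
  have mG n : AEStronglyMeasurable (G n) ν := (mβ n).smul ((mY n).sub mY₀.1)
  have hFG : ∀ n, ((fun x => α n x • X x + β n x • Y n x) -
      fun x => α₀ x • X x + β₀ x • Y₀ x) = F n + G n := by
    intro n
    ext1 x
    simp only [Pi.sub_apply, Pi.add_apply, hF, hG]
    module
  have lF : Tendsto (fun n => eLpNorm (F n) 2 ν) atTop (𝓝 0) := by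
    have hB : MemLp (fun x => 2 * A * A + 2 * A * ‖Y₀ x‖) 2 ν :=
      (memLp_const (2 * A * A)).add (mY₀.norm.const_mul (2 * A))
    refine tendsto_eLpNorm_two_zero_of_dominated mF hB
      (fun n => Eventually.of_forall fun x => ?_) ?_
    · refine (norm_add_le _ _).trans (add_le_add ?_ ?_)
      · rw [norm_smul]
        refine mul_le_mul ((norm_sub_le _ _).trans ?_) (hX x) (norm_nonneg _) (by positivity)
        linarith [hα n x, hα₀ x, Real.norm_eq_abs (α n x), Real.norm_eq_abs (α₀ x)]
      · rw [norm_smul]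
        refine mul_le_mul_of_nonneg_right ((norm_sub_le _ _).trans ?_) (norm_nonneg _)
        linarith [hβ n x, hβ₀ x, Real.norm_eq_abs (β n x), Real.norm_eq_abs (β₀ x)]
    · filter_upwards [lα, lβ] with x h1 h2
      have h3 := ((h1.sub_const (α₀ x)).smul_const (X x)).add
        ((h2.sub_const (β₀ x)).smul_const (Y₀ x))
      simpa using h3
  have lG : Tendsto (fun n => eLpNorm (G n) 2 ν) atTop (𝓝 0) := by
    have h0 : Tendsto (fun n => ENNReal.ofReal A * eLpNorm (Y n - Y₀) 2 ν) atTop (𝓝 0) := by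
      simpa using ENNReal.Tendsto.const_mul lY (Or.inr ENNReal.ofReal_ne_top)
    refine tendsto_of_tendsto_of_tendsto_of_le_of_le tendsto_const_nhds h0
      (fun _ => zero_le) fun n => ?_
    refine eLpNorm_le_mul_eLpNorm_of_ae_le_mul (Eventually.of_forall fun x => ?_) 2
    simp only [hG]
    rw [norm_smul]
    exact mul_le_mul_of_nonneg_right (hβ n x) (norm_nonneg _)
  simp only [hFG]
  refine tendsto_of_tendsto_of_tendsto_of_le_of_le tendsto_const_nhds
    (by simpa using lF.add lG) (fun _ => zero_le) fun n => ?_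
  exact eLpNorm_add_le (mF n) (mG n) one_le_two

lemma gradient_mul_comp {φ ψ : EuclideanSpace ℝ (Fin N) → ℝ} {g : ℝ → ℝ}
    (hφ : Differentiable ℝ φ) (hψ : Differentiable ℝ ψ) (hg : Differentiable ℝ g)
    (x : EuclideanSpace ℝ (Fin N)) :
    ∇ (ψ * (g ∘ φ)) x = g (φ x) • ∇ ψ x + (ψ x * deriv g (φ x)) • ∇ φ x := by
  refine gradient_eq_of_fderiv fun y => ?_
  have h1 : HasFDerivAt (g ∘ φ) (deriv g (φ x) • fderiv ℝ φ x) x :=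
    (hg (φ x)).hasDerivAt.comp_hasFDerivAt x (hφ x).hasFDerivAt
  rw [((hψ x).hasFDerivAt.mul h1).fderiv, inner_add_left, real_inner_smul_left,
    real_inner_smul_left, inner_gradient, inner_gradient]
  simp
  ring

/-- The function `ψ g(u)` belongs to `H₀¹(Ω)` and obeys the product and chain rules. The condition
`htest` holds if `ψ` is a test function, and also if `g 0 = 0`. -/
lemma exists_H01_mul_comp (hΩb : Bornology.IsBounded Ω) {ψ : EuclideanSpace ℝ (Fin N) → ℝ}
    {g : ℝ → ℝ} (hψ : ContDiff ℝ ∞ ψ) (hg : ContDiff ℝ ∞ g) {A : ℝ}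
    (hψA : ∀ x, |ψ x| ≤ A) (hψA' : ∀ x, ‖∇ ψ x‖ ≤ A) (hgA : ∀ s, |g s| ≤ A)
    (hgA' : ∀ s, |deriv g s| ≤ A)
    (htest : ∀ φ, IsTestFunction Ω φ → IsTestFunction Ω (ψ * (g ∘ φ))) (u : H01 Ω) :
    ∃ v : H01 Ω, (val v =ᵐ[volume.restrict Ω] fun x => ψ x * g (val u x)) ∧
      grad v =ᵐ[volume.restrict Ω]
        fun x => g (val u x) • ∇ ψ x + (ψ x * deriv g (val u x)) • grad u x := by
  have hA : 0 ≤ A := (abs_nonneg _).trans (hψA 0)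
  have : IsFiniteMeasure (volume.restrict Ω) :=
    ⟨by rw [Measure.restrict_apply_univ]; exact hΩb.measure_lt_top⟩
  obtain ⟨φ, hφ, -, l2, hae⟩ := exists_seq_isTestFunction u
  have hgc : Continuous g := hg.continuous
  have hgc' : Continuous (deriv g) := hg.continuous_deriv (by simp)
  have mψ : AEStronglyMeasurable ψ (volume.restrict Ω) := hψ.continuous.aestronglyMeasurable
  have mψ' : AEStronglyMeasurable (∇ ψ) (volume.restrict Ω) :=
    (continuous_gradient hψ).aestronglyMeasurable
  have mu := (memLp_val u).1
  have mu' := (memLp_grad u).1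
  have mg := hgc.comp_aestronglyMeasurable mu
  have mg' := hgc'.comp_aestronglyMeasurable mu
  have mgn n := hgc.comp_aestronglyMeasurable ((hφ n).memLp 2).1
  have mgn' n := hgc'.comp_aestronglyMeasurable ((hφ n).memLp 2).1
  have lg : ∀ᵐ x ∂(volume.restrict Ω), Tendsto (fun n => g (φ n x)) atTop (𝓝 (g (val u x))) :=
    hae.mono fun x hx => (hgc.tendsto _).comp hx
  have lg' : ∀ᵐ x ∂(volume.restrict Ω),
      Tendsto (fun n => deriv g (φ n x)) atTop (𝓝 (deriv g (val u x))) :=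
    hae.mono fun x hx => (hgc'.tendsto _).comp hx
  have hdiff : ∀ s t, |g s - g t| ≤ 2 * A := fun s t =>
    (abs_sub _ _).trans (by linarith [hgA s, hgA t])
  refine exists_H01_of_tendsto (fun n => htest _ (hφ n)) ?_ ?_ ?_ ?_
  · refine MemLp.of_bound (mψ.mul mg) (A * A) (Eventually.of_forall fun x => ?_)
    rw [norm_mul]
    exact mul_le_mul (hψA x) (hgA _) (norm_nonneg _) hA
  · refine MemLp.add ?_ ?_
    · refine MemLp.of_bound (mg.smul mψ') (A * A) (Eventually.of_forall fun x => ?_)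
      rw [norm_smul]
      exact mul_le_mul (hgA _) (hψA' x) (norm_nonneg _) hA
    · refine MemLp.of_le_mul (c := A * A) (memLp_grad u) ((mψ.mul mg').smul mu')
        (Eventually.of_forall fun x => ?_)
      rw [norm_smul, norm_mul]
      gcongr
      exacts [hψA x, hgA' _]
  · refine tendsto_eLpNorm_two_zero_of_dominated (B := fun _ => A * (2 * A))
      (fun n => (mψ.mul (mgn n)).sub (mψ.mul mg)) (memLp_const _)
      (fun n => Eventually.of_forall fun x => ?_) ?_
    · have : (ψ * (g ∘ φ n) - fun x => ψ x * g (val u x)) x =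
          ψ x * (g (φ n x) - g (val u x)) := by simp; ring
      rw [this, norm_mul]
      exact mul_le_mul (hψA x) (hdiff _ _) (norm_nonneg _) hA
    · filter_upwards [lg] with x hx
      simpa using (hx.const_mul (ψ x)).sub_const (ψ x * g (val u x))
  · have hgrad : ∀ n, ∇ (ψ * (g ∘ φ n)) =
        fun x => g (φ n x) • ∇ ψ x + (ψ x * deriv g (φ n x)) • ∇ (φ n) x := fun n =>
      funext fun x => gradient_mul_comp ((hφ n).1.differentiable (by simp))
        (hψ.differentiable (by simp)) (hg.differentiable (by simp)) x
    simp only [hgrad]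
    have hprod : ∀ x s, |ψ x * deriv g s| ≤ A * A := fun x s => by
      rw [abs_mul]; exact mul_le_mul (hψA x) (hgA' _) (abs_nonneg _) hA
    refine tendsto_eLpNorm_smul_add_smul (A := A + A * A) (α := fun n x => g (φ n x))
      (α₀ := fun x => g (val u x)) (β := fun n x => ψ x * deriv g (φ n x))
      (β₀ := fun x => ψ x * deriv g (val u x)) (Y := fun n => ∇ (φ n)) mgn mg
      (fun n => mψ.mul (mgn' n)) (mψ.mul mg') mψ' (memLp_grad u)
      (fun n => ((hφ n).memLp_gradient 2).1)
      (fun n x => (hgA _).trans (by nlinarith)) (fun x => (hgA _).trans (by nlinarith))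
      (fun n x => (hprod _ _).trans (by linarith)) (fun x => (hprod _ _).trans (by linarith))
      (fun x => (hψA' x).trans (by nlinarith)) lg ?_ l2
    exact lg'.mono fun x hx => hx.const_mul _

end Nonlinear

/-! ### Positivity of weak solutions -/

section Positivity

variable {N : ℕ} {Ω : Set (EuclideanSpace ℝ (Fin N))}

lemma exists_deriv_smoothTransition_bound : ∃ M, ∀ s, |deriv Real.smoothTransition s| ≤ M := by
  have hc : Continuous (deriv Real.smoothTransition) :=
    (Real.smoothTransition.contDiff (n := 1)).continuous_deriv le_rfl
  obtain ⟨M, hM⟩ := isCompact_Icc.exists_bound_of_continuousOn (s := Icc (0 : ℝ) 1)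
    hc.continuousOn
  refine ⟨max M 0, fun s => ?_⟩
  by_cases hs : s ∈ Icc (0 : ℝ) 1
  · exact (hM s hs).trans (le_max_left _ _)
  · have h0 : deriv Real.smoothTransition s = 0 := by
      rw [mem_Icc, not_and_or, not_le, not_le] at hs
      rcases hs with hs | hs
      · have : Real.smoothTransition =ᶠ[𝓝 s] fun _ => 0 := by
          filter_upwards [Iio_mem_nhds hs] with t ht
          exact Real.smoothTransition.zero_of_nonpos (le_of_lt ht)
        rw [this.deriv_eq, deriv_const]
      · have : Real.smoothTransition =ᶠ[𝓝 s] fun _ => 1 := by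
          filter_upwards [Ioi_mem_nhds hs] with t ht
          exact Real.smoothTransition.one_of_one_le (le_of_lt ht)
        rw [this.deriv_eq, deriv_const]
    rw [h0, abs_zero]
    exact le_max_right _ _

/-- Weak minimum principle. The function `H(w)`, with `H` smooth and nonincreasing and positive
exactly on the negative reals, makes one side of the weak equation nonpositive and the other one
nonnegative. -/
lemma val_nonneg_of_weak (hΩb : Bornology.IsBounded Ω) {f : EuclideanSpace ℝ (Fin N) → ℝ}
    (hfpos : ∀ᵐ x ∂(volume.restrict Ω), 0 < f x)
    (hfi : ∀ v : H01 Ω, IntegrableOn (fun x => f x * val v x) Ω) {w : H01 Ω}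
    (hw : ∀ v : H01 Ω, ∫ x in Ω, ⟪grad w x, grad v x⟫ = ∫ x in Ω, f x * val v x) :
    ∀ᵐ x ∂(volume.restrict Ω), 0 ≤ val w x := by
  obtain ⟨M, hM⟩ := exists_deriv_smoothTransition_bound
  set H : ℝ → ℝ := fun s => Real.smoothTransition (-s) with hH
  have hHd : ∀ s, deriv H s = -deriv Real.smoothTransition (-s) := fun s =>
    deriv_comp_neg Real.smoothTransition s
  have hHc : ContDiff ℝ ∞ H := Real.smoothTransition.contDiff.comp contDiff_neg
  have h1 : ∀ x : EuclideanSpace ℝ (Fin N),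
      ∇ (fun _ : EuclideanSpace ℝ (Fin N) => (1 : ℝ)) x = 0 := fun x =>
    gradient_eq_of_fderiv fun y => by simp
  obtain ⟨v, hv, hv'⟩ := exists_H01_mul_comp (A := max 1 M) hΩb (ψ := fun _ => 1) (g := H)
    contDiff_const hHc (fun x => by simp) (fun x => by simp [h1])
    (fun s => by
      rw [abs_of_nonneg (Real.smoothTransition.nonneg _)]
      exact (Real.smoothTransition.le_one _).trans (le_max_left _ _))
    (fun s => by rw [hHd, abs_neg]; exact (hM _).trans (le_max_right _ _))
    (fun φ hφ => by
      have : (fun _ => 1 : EuclideanSpace ℝ (Fin N) → ℝ) * (H ∘ φ) = H ∘ φ := by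
        ext x; simp
      rw [this]
      exact hφ.comp hHc (by simp [hH]))
    w
  have hle : ∫ x in Ω, ⟪grad w x, grad v x⟫ ≤ 0 := by
    refine integral_nonpos_of_ae ?_
    filter_upwards [hv'] with x hx
    rw [hx, h1, hHd, smul_zero, zero_add, real_inner_smul_right, real_inner_self_eq_norm_sq]
    have := Real.smoothTransition.monotone.deriv_nonneg (x := -val w x)
    simp only [Pi.zero_apply]
    nlinarith [sq_nonneg ‖grad w x‖]
  have hnn : 0 ≤ᵐ[volume.restrict Ω] fun x => f x * val v x := by
    filter_upwards [hv, hfpos] with x hx hf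
    rw [hx]
    exact mul_nonneg hf.le (by simpa [hH] using Real.smoothTransition.nonneg _)
  have hz : ∫ x in Ω, f x * val v x = 0 :=
    le_antisymm ((hw v).symm.trans_le hle) (integral_nonneg_of_ae hnn)
  rw [integral_eq_zero_iff_of_nonneg_ae hnn (hfi v)] at hz
  filter_upwards [hz, hv, hfpos] with x h2 h3 h4
  simp only [Pi.zero_apply, h3, one_mul, mul_eq_zero, h4.ne', false_or, hH] at h2
  rw [Real.smoothTransition.zero_iff_nonpos] at h2
  linarith

/-- The derivative of the functions `g(s) = n σ(-n s)`, for the logistic function `σ`. They satisfy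
`g² ≤ -g'` on `s ≥ 0` and are bounded, while `g 0 = n / 2` grows with `n`. They replace
`1 / s` as a test nonlinearity. -/
lemma deriv_logistic (n s : ℝ) : deriv (fun s => n * Real.sigmoid (-(n * s))) s =
    -(n ^ 2 * (Real.sigmoid (-(n * s)) * (1 - Real.sigmoid (-(n * s))))) := by
  have h : HasDerivAt (fun s => n * Real.sigmoid (-(n * s)))
      (n * (Real.sigmoid (-(n * s)) * (1 - Real.sigmoid (-(n * s))) * (-(n * 1)))) s := by
    have h0 : HasDerivAt (fun s => -(n * s)) (-(n * 1)) s := ((hasDerivAt_id s).const_mul n).neg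
    exact ((Real.hasDerivAt_sigmoid (-(n * s))).comp s h0).const_mul n
  rw [h.deriv]; ring

/-- Testing a nonnegative supersolution with `φ² g(w)`, where `g² ≤ -g'`, bounds `∫ f φ² g(w)` by
the energy of `φ`: the gradient term of `w` is absorbed by `g'`. -/
lemma integral_logistic_le (hΩb : Bornology.IsBounded Ω) {f : EuclideanSpace ℝ (Fin N) → ℝ}
    {w : H01 Ω} (hw : ∀ v : H01 Ω, ∫ x in Ω, ⟪grad w x, grad v x⟫ = ∫ x in Ω, f x * val v x)
    (hw0 : ∀ᵐ x ∂(volume.restrict Ω), 0 ≤ val w x) {φ : EuclideanSpace ℝ (Fin N) → ℝ}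
    (hφ : IsTestFunction Ω φ) {n : ℝ} (hn : 0 < n) :
    ∃ v : H01 Ω, (val v =ᵐ[volume.restrict Ω]
        fun x => φ x ^ 2 * (n * Real.sigmoid (-(n * val w x)))) ∧
      ∫ x in Ω, f x * val v x ≤ ∫ x in Ω, ‖∇ φ x‖ ^ 2 := by
  set g : ℝ → ℝ := fun s => n * Real.sigmoid (-(n * s)) with hg
  have hgc : ContDiff ℝ ∞ g := contDiff_const.mul
    ((contDiff_sigmoid.of_le le_top).comp (contDiff_const.mul contDiff_id).neg)
  have hφφ : IsTestFunction Ω (φ * φ) := hφ.mul_left hφ.1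
  have hgrad : ∀ x, ∇ (φ * φ) x = (2 * φ x) • ∇ φ x := fun x =>
    gradient_eq_of_fderiv fun y => by
      have hd := (hφ.1.differentiable (by simp) x).hasFDerivAt
      rw [(hd.mul hd).fderiv, real_inner_smul_left, inner_gradient]
      simp; ring
  obtain ⟨A₁, hA₁⟩ := hφφ.2.1.exists_bound_of_continuous hφφ.1.continuous
  obtain ⟨A₂, hA₂⟩ := hφφ.hasCompactSupport_gradient.exists_bound_of_continuous
    (continuous_gradient hφφ.1)
  have hσ : ∀ s, 0 < Real.sigmoid s ∧ Real.sigmoid s < 1 := fun s =>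
    ⟨Real.sigmoid_pos s, Real.sigmoid_lt_one s⟩
  obtain ⟨v, hv, hv'⟩ := exists_H01_mul_comp (A := max (max A₁ A₂) (max n (n ^ 2))) hΩb
    (ψ := φ * φ) (g := g) hφφ.1 hgc
    (fun x => (hA₁ x).trans ((le_max_left _ _).trans (le_max_left _ _)))
    (fun x => (hA₂ x).trans ((le_max_right _ _).trans (le_max_left _ _)))
    (fun s => by
      refine le_trans ?_ ((le_max_left n (n ^ 2)).trans (le_max_right _ _))
      rw [abs_of_nonneg (mul_nonneg hn.le (hσ _).1.le)]
      nlinarith [(hσ (-(n * s))).2])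
    (fun s => by
      refine le_trans ?_ ((le_max_right n (n ^ 2)).trans (le_max_right _ _))
      have h := hσ (-(n * s))
      rw [hg, deriv_logistic, abs_neg, abs_of_nonneg (mul_nonneg (sq_nonneg _)
        (mul_nonneg h.1.le (by linarith)))]
      refine mul_le_of_le_one_right (sq_nonneg _) ?_
      nlinarith)
    (fun χ hχ => hφφ.mul_left (hgc.comp hχ.1)) w
  refine ⟨v, hv.trans (Eventually.of_forall fun x => by simp [hg, pow_two]), ?_⟩
  rw [← hw v]
  refine integral_mono_ae (L2.integrable_inner (gradL Ω w) (gradL Ω v))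
    ((hφ.memLp_gradient 2).integrable_norm_pow two_ne_zero) ?_
  filter_upwards [hv', hw0] with x hx h0
  have hs : Real.sigmoid (-(n * val w x)) ≤ 1 / 2 := by
    have := Real.sigmoid_le (show -(n * val w x) ≤ 0 by nlinarith)
    rw [Real.sigmoid_zero] at this
    linarith
  have hgg : g (val w x) ^ 2 ≤ -deriv g (val w x) := by
    rw [hg, deriv_logistic, neg_neg, mul_pow]
    refine mul_le_mul_of_nonneg_left ?_ (sq_nonneg n)
    nlinarith [(hσ (-(n * val w x))).1]
  rw [hx, hgrad, inner_add_right, real_inner_smul_right, real_inner_smul_right,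
    real_inner_smul_right, real_inner_self_eq_norm_sq]
  simp only [Pi.mul_apply]
  set G := g (val w x)
  -- The square `‖∇φ - φ G ∇w‖² ≥ 0`.
  have h3 : 2 * (φ x * G) * ⟪grad w x, ∇ φ x⟫ ≤
      ‖∇ φ x‖ ^ 2 + (φ x * G) ^ 2 * ‖grad w x‖ ^ 2 := by
    have h4 := sq_nonneg ‖∇ φ x - (φ x * G) • grad w x‖
    rw [norm_sub_sq_real, real_inner_smul_right, real_inner_comm, norm_smul, mul_pow,
      Real.norm_eq_abs, sq_abs] at h4
    linarith
  have h5 : (φ x * G) ^ 2 * ‖grad w x‖ ^ 2 ≤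
      φ x * φ x * -deriv g (val w x) * ‖grad w x‖ ^ 2 := by
    refine mul_le_mul_of_nonneg_right ?_ (sq_nonneg _)
    rw [mul_pow, ← pow_two]
    exact mul_le_mul_of_nonneg_left hgg (sq_nonneg _)
  linarith

/-- Strong minimum principle for a right-hand side that is positive almost everywhere. On the zero
set of `w` the bound of `integral_logistic_le` has the factor `n / 2`, so `f φ²` vanishes there for
every test function `φ`. -/
lemma isPositive_of_weak (hΩ : IsOpen Ω) (hΩb : Bornology.IsBounded Ω)
    {f : EuclideanSpace ℝ (Fin N) → ℝ}
    (hfpos : ∀ᵐ x ∂(volume.restrict Ω), 0 < f x)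
    (hfi : ∀ v : H01 Ω, IntegrableOn (fun x => f x * val v x) Ω) {w : H01 Ω}
    (hw : ∀ v : H01 Ω, ∫ x in Ω, ⟪grad w x, grad v x⟫ = ∫ x in Ω, f x * val v x) :
    IsPositive w := by
  have hw0 := val_nonneg_of_weak hΩb hfpos hfi hw
  have hmeas : Measurable (val w) := (Lp.stronglyMeasurable (valL Ω w)).measurable
  set Z : Set (EuclideanSpace ℝ (Fin N)) := {x | val w x ≤ 0} with hZ
  have hZm : MeasurableSet Z := hmeas measurableSet_Iic
  have hφZ : ∀ φ, IsTestFunction Ω φ → ∀ᵐ x ∂(volume.restrict Ω), x ∈ Z → φ x = 0 := by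
    intro φ hφ
    obtain ⟨v₀, hv₀, -⟩ := (hφ.mul_left hφ.1).exists_H01
    have hi0 : IntegrableOn (fun x => f x * φ x ^ 2) Ω := by
      refine (integrable_congr ?_).1 (hfi v₀)
      filter_upwards [hv₀] with x hx
      rw [hx, Pi.mul_apply, pow_two]
    have hiZ : Integrable (Z.indicator fun x => f x * φ x ^ 2) (volume.restrict Ω) :=
      hi0.indicator hZm
    have hnn : 0 ≤ᵐ[volume.restrict Ω] Z.indicator fun x => f x * φ x ^ 2 := by
      filter_upwards [hfpos] with x hx
      exact indicator_apply_nonneg (fun _ => mul_nonneg hx.le (sq_nonneg _))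
    set I := ∫ x in Ω, Z.indicator (fun x => f x * φ x ^ 2) x with hI
    have hbound : ∀ n : ℝ, 0 < n → n / 2 * I ≤ ∫ x in Ω, ‖∇ φ x‖ ^ 2 := by
      intro n hn
      obtain ⟨v, hv, hle⟩ := integral_logistic_le hΩb hw hw0 hφ hn
      refine le_trans ?_ hle
      rw [hI, ← integral_const_mul]
      refine integral_mono_ae (hiZ.const_mul _) (hfi v) ?_
      filter_upwards [hv, hfpos, hw0] with x hx hf h0
      rw [hx]
      by_cases hxZ : x ∈ Z
      · have : val w x = 0 := le_antisymm hxZ h0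
        simp only [indicator_of_mem hxZ, this, mul_zero, neg_zero, Real.sigmoid_zero]
        apply le_of_eq; ring
      · simp only [indicator_of_notMem hxZ, mul_zero]
        have := Real.sigmoid_pos (-(n * val w x))
        positivity
    have hI0 : I = 0 := by
      refine le_antisymm (le_of_not_gt fun hpos => ?_) (integral_nonneg_of_ae hnn)
      set K := ∫ x in Ω, ‖∇ φ x‖ ^ 2
      have hK : 0 ≤ K := integral_nonneg fun x => sq_nonneg _
      have := hbound (2 * (K + 1) / I) (by positivity)
      field_simp at this
      linarith
    rw [hI, integral_eq_zero_iff_of_nonneg_ae hnn hiZ] at hI0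
    filter_upwards [hI0, hfpos] with x hx hf hxZ
    simpa [indicator_of_mem hxZ, hf.ne'] using hx
  have hnull : (volume.restrict Ω) (Ω ∩ Z) = 0 := by
    refine measure_null_of_locally_null _ fun x hx => ?_
    obtain ⟨φ, hs, hc, hd, -, h1⟩ := exists_contDiff_tsupport_subset (n := ⊤)
      (hΩ.mem_nhds hx.1)
    refine ⟨Ω ∩ Z ∩ {y | φ y ≠ 0}, inter_mem_nhdsWithin _
      ((isOpen_ne_fun hd.continuous continuous_const).mem_nhds (by simp [h1])), ?_⟩
    refine measure_mono_null (fun y hy => ?_) (ae_iff.1 (hφZ φ ⟨hd, hc, hs⟩))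
    exact fun h => hy.2 (h hy.1.2)
  have hΩae : ∀ᵐ x ∂(volume.restrict Ω), x ∈ Ω := ae_restrict_mem hΩ.measurableSet
  filter_upwards [hΩae, measure_eq_zero_iff_ae_notMem.1 hnull] with x h1 h2
  exact not_le.1 fun h => h2 ⟨h1, h⟩

end Positivity

/-! ### The Sobolev constant and the Riesz representative of the right-hand side -/

section Riesz

variable {N : ℕ} {Ω : Set (EuclideanSpace ℝ (Fin N))} {p : ℝ≥0∞}

lemma not_ae_restrict_false (hΩ : IsOpen Ω) (hne : Ω.Nonempty) :
    ¬ ∀ᵐ _ ∂(volume.restrict Ω), False := by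
  intro h
  rw [ae_iff] at h
  simp only [not_false_eq_true, Set.ofPred_true, Measure.restrict_apply_univ] at h
  exact (hΩ.measure_pos volume hne).ne' h

lemma val_zero : val (0 : H01 Ω) =ᵐ[volume.restrict Ω] 0 := Lp.coeFn_zero _ _ _

lemma IsPositive.ne_zero (hΩ : IsOpen Ω) (hne : Ω.Nonempty) {w : H01 Ω} (hw : IsPositive w) :
    w ≠ 0 := by
  rintro rfl
  refine not_ae_restrict_false hΩ hne ?_
  filter_upwards [hw, val_zero] with x h1 h2
  rw [h2] at h1
  exact lt_irrefl _ h1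

/-- A nonzero function of `H₀¹(Ω)` that vanishes on a nonempty open subset of `Ω`. -/
lemma exists_ne_zero_vanishing (hN : 1 ≤ N) (hΩ : IsOpen Ω) (hne : Ω.Nonempty) :
    ∃ z : H01 Ω, z ≠ 0 ∧ ∃ U ⊆ Ω, IsOpen U ∧ U.Nonempty ∧
      ∀ᵐ x ∂(volume.restrict Ω), x ∈ U → val z x = 0 := by
  obtain ⟨x₀, hx₀⟩ := hne
  have : Nonempty (Fin N) := ⟨⟨0, hN⟩⟩
  obtain ⟨x₁, hx₁, hne⟩ : ∃ x₁ ∈ Ω, x₁ ≠ x₀ := by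
    have h := inter_mem (mem_nhdsWithin_of_mem_nhds (hΩ.mem_nhds hx₀))
      (self_mem_nhdsWithin (a := x₀) (s := {x₀}ᶜ))
    exact Filter.nonempty_of_mem h
  obtain ⟨φ, hs, hc, hd, -, h1⟩ := exists_contDiff_tsupport_subset (n := ⊤) (s := Ω \ {x₁})
    (x := x₀) ((hΩ.sdiff isClosed_singleton).mem_nhds ⟨hx₀, hne.symm⟩)
  have hφ : IsTestFunction Ω φ := ⟨hd, hc, hs.trans sdiff_subset⟩
  obtain ⟨z, hz, -⟩ := hφ.exists_H01
  refine ⟨z, ?_, Ω \ tsupport φ, sdiff_subset, hΩ.sdiff (isClosed_tsupport φ),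
    ⟨x₁, hx₁, fun h => (hs h).2 rfl⟩, ?_⟩
  · rintro rfl
    have h0 : ∀ᵐ x ∂(volume.restrict Ω), φ x = 0 := by
      filter_upwards [hz, val_zero] with x h2 h3
      rw [← h2, h3, Pi.zero_apply]
    rw [ae_restrict_iff' hΩ.measurableSet, ae_iff] at h0
    have hO : IsOpen (Ω ∩ {x | φ x ≠ 0}) :=
      hΩ.inter (isOpen_ne_fun hd.continuous continuous_const)
    refine (hO.measure_pos volume ⟨x₀, hx₀, by simp [h1]⟩).ne' (measure_mono_null ?_ h0)
    exact fun x hx h => hx.2 (h hx.1)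
  · filter_upwards [hz] with x hx hxU
    rw [hx, image_eq_zero_of_notMem_tsupport hxU.2]

lemma exists_notMem_span_of_isPositive (hN : 1 ≤ N) (hΩ : IsOpen Ω) (hne : Ω.Nonempty) {w : H01 Ω}
    (hw : IsPositive w) : ∃ z : H01 Ω, z ∉ Submodule.span ℝ {w} := by
  obtain ⟨z, hz, U, hUΩ, hU, hUne, h0⟩ := exists_ne_zero_vanishing hN hΩ hne
  refine ⟨z, fun h => ?_⟩
  obtain ⟨c, rfl⟩ := Submodule.mem_span_singleton.1 h
  have hc : c ≠ 0 := by rintro rfl; simp at hz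
  have hn : ∀ᵐ x ∂(volume.restrict Ω), x ∉ U := by
    filter_upwards [h0, hw, val_smul c w] with x h1 h2 h3 hxU
    have := h1 hxU
    rw [h3, Pi.smul_apply, smul_eq_mul] at this
    exact mul_ne_zero hc h2.ne' this
  rw [ae_restrict_iff' hΩ.measurableSet, ae_iff] at hn
  exact (hU.measure_pos volume hUne).ne' (measure_mono_null (t := {x | ¬(x ∈ Ω → x ∉ U)})
    (fun x hx h => h (hUΩ hx) hx) hn)

lemma sobolevConst_mul_le (u : H01 Ω) :
    sobolevConst Ω p * (eLpNorm (val u) p (volume.restrict Ω)).toReal ^ 2 ≤ ‖gradL Ω u‖ ^ 2 := by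
  set P := (eLpNorm (val u) p (volume.restrict Ω)).toReal with hP
  rcases (show 0 ≤ P from ENNReal.toReal_nonneg).eq_or_lt with h0 | h0
  · rw [← h0]; simp
  · have hu : u ≠ 0 := by
      rintro rfl
      rw [hP, eLpNorm_congr_ae val_zero] at h0
      simp at h0
    rw [← energyNorm_eq, ← le_div_iff₀ (by positivity)]
    refine csInf_le ⟨0, ?_⟩ ⟨u, hu, rfl⟩
    rintro _ ⟨v, -, rfl⟩
    positivity

lemma sobolevConst_pos (hN : 1 ≤ N) (hΩ : IsOpen Ω) (hne : Ω.Nonempty)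
    (hΩb : Bornology.IsBounded Ω) (hp : IsSobolevExponent N p) : 0 < sobolevConst Ω p := by
  obtain ⟨C, hC, h⟩ := exists_sobolev hΩb hp
  obtain ⟨z, hz, -⟩ := exists_ne_zero_vanishing hN hΩ hne
  refine lt_of_lt_of_le (show 0 < (C ^ 2)⁻¹ by positivity) (le_csInf ⟨_, z, hz, rfl⟩ ?_)
  rintro _ ⟨u, hu, rfl⟩
  -- The quotient is not the junk value of a division by zero: `val u` is not the zero function.
  have hP : 0 < (eLpNorm (val u) p (volume.restrict Ω)).toReal := by
    refine ENNReal.toReal_pos (fun h0 => hu ?_) (h u).1.2.ne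
    rw [eLpNorm_eq_zero_iff (h u).1.1 (zero_lt_one.trans_le hp.one_le).ne'] at h0
    exact eq_zero_of_val_ae_eq_zero hΩ h0
  rw [energyNorm_eq, le_div_iff₀ (by positivity), inv_mul_le_iff₀ (by positivity), ← mul_pow]
  exact pow_le_pow_left₀ hP.le (h u).2 2

lemma integrable_mul_val (hp1 : 1 ≤ p) {f : EuclideanSpace ℝ (Fin N) → ℝ}
    (hf : MemLp f p.conjExponent (volume.restrict Ω)) {v : H01 Ω}
    (hv : MemLp (val v) p (volume.restrict Ω)) : IntegrableOn (fun x => f x * val v x) Ω := by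
  have := (ENNReal.HolderConjugate.conjExponent hp1).symm
  exact hf.integrable_mul hv

lemma abs_integral_mul_val_le (hp1 : 1 ≤ p) {f : EuclideanSpace ℝ (Fin N) → ℝ}
    (hf : MemLp f p.conjExponent (volume.restrict Ω)) {v : H01 Ω}
    (hv : MemLp (val v) p (volume.restrict Ω)) :
    |∫ x in Ω, f x * val v x| ≤ (eLpNorm f p.conjExponent (volume.restrict Ω)).toReal *
      (eLpNorm (val v) p (volume.restrict Ω)).toReal := by
  have := (ENNReal.HolderConjugate.conjExponent hp1).symm
  have h1 : eLpNorm (f • val v) 1 (volume.restrict Ω) ≤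
      eLpNorm f p.conjExponent (volume.restrict Ω) * eLpNorm (val v) p (volume.restrict Ω) :=
    eLpNorm_smul_le_mul_eLpNorm hv.1 hf.1
  rw [← ENNReal.toReal_mul]
  refine le_trans ?_ (ENNReal.toReal_mono (ENNReal.mul_ne_top hf.2.ne hv.2.ne) h1)
  rw [eLpNorm_one_eq_lintegral_enorm, ← integral_norm_eq_lintegral_enorm (hf.1.smul hv.1)]
  exact norm_integral_le_integral_norm (fun x => f x * val v x)

/-- The right-hand side has a Riesz representative for the Dirichlet inner product, that is, the
weak solution of `-Δw = f`. -/
lemma exists_weak_poisson (hN : 1 ≤ N) (hΩb : Bornology.IsBounded Ω)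
    (hp : IsSobolevExponent N p) {f : EuclideanSpace ℝ (Fin N) → ℝ}
    (hf : MemLp f p.conjExponent (volume.restrict Ω)) :
    ∃ w : H01 Ω, ∀ v : H01 Ω, ⟪gradL Ω w, gradL Ω v⟫ = ∫ x in Ω, f x * val v x := by
  obtain ⟨C, hC, h⟩ := exists_sobolev hΩb hp
  obtain ⟨K, hK, hP⟩ := exists_poincare hN hΩb
  have hi : ∀ v : H01 Ω, IntegrableOn (fun x => f x * val v x) Ω := fun v =>
    integrable_mul_val hp.one_le hf (h v).1
  let F₀ : H01 Ω →ₗ[ℝ] ℝ :=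
    { toFun := fun v => ∫ x in Ω, f x * val v x
      map_add' := fun u v => by
        rw [← integral_add (hi u) (hi v)]
        refine integral_congr_ae ?_
        filter_upwards [val_add u v] with x hx
        rw [hx, Pi.add_apply, mul_add]
      map_smul' := fun c v => by
        rw [RingHom.id_apply, smul_eq_mul, ← integral_const_mul]
        refine integral_congr_ae ?_
        filter_upwards [val_smul c v] with x hx
        rw [hx, Pi.smul_apply, smul_eq_mul]; ring }
  let F : H01 Ω →L[ℝ] ℝ := F₀.mkContinuous
    ((eLpNorm f p.conjExponent (volume.restrict Ω)).toReal * C) fun v => by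
      rw [mul_assoc]
      refine (abs_integral_mul_val_le hp.one_le hf (h v).1).trans
        (mul_le_mul_of_nonneg_left ((h v).2.trans ?_) ENNReal.toReal_nonneg)
      gcongr
      refine abs_le_of_sq_le_sq' ?_ (norm_nonneg v) |>.2
      rw [norm_sq_eq v]
      linarith [sq_nonneg ‖valL Ω v‖]
  let B : H01 Ω →L[ℝ] H01 Ω →L[ℝ] ℝ := (innerSL ℝ).bilinearComp (gradL Ω) (gradL Ω)
  have hB : ∀ u v, B u v = ⟪gradL Ω u, gradL Ω v⟫ := fun u v => rfl
  have hcoer : IsCoercive B := by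
    refine ⟨(K ^ 2)⁻¹, by positivity, fun u => ?_⟩
    rw [hB, real_inner_self_eq_norm_sq, mul_assoc, inv_mul_le_iff₀ (by positivity), ← pow_two,
      ← mul_pow]
    exact pow_le_pow_left₀ (norm_nonneg _) (hP u) 2
  refine ⟨hcoer.continuousLinearEquivOfBilin.symm ((InnerProductSpace.toDual ℝ _).symm F),
    fun v => ?_⟩
  rw [← hB, ← hcoer.continuousLinearEquivOfBilin_apply, ContinuousLinearEquiv.apply_symm_apply,
    InnerProductSpace.toDual_symm_apply]
  rfl

lemma eLpNorm_conjExponent_pos (hΩ : IsOpen Ω) (hne : Ω.Nonempty)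
    {f : EuclideanSpace ℝ (Fin N) → ℝ} (hp1 : 1 ≤ p)
    (hf : MemLp f p.conjExponent (volume.restrict Ω))
    (hfpos : ∀ᵐ x ∂(volume.restrict Ω), 0 < f x) :
    0 < (eLpNorm f p.conjExponent (volume.restrict Ω)).toReal := by
  refine ENNReal.toReal_pos (fun h0 => ?_) hf.2.ne
  have hq : p.conjExponent ≠ 0 :=
    (ENNReal.HolderConjugate.conjExponent hp1).symm.ne_zero
  rw [eLpNorm_eq_zero_iff hf.1 hq] at h0
  refine not_ae_restrict_false hΩ hne ?_
  filter_upwards [h0, hfpos] with x h1 h2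
  exact h2.ne' h1

/-- The right-hand side is the value of the cubic `a s - b s³` at `s = (2a / (3b))^{1/2}`, so below
`muStar` the scalar equation has two positive solutions, the larger one beyond that `s`. -/
lemma mul_norm_lt_of_lt_muStar {a b μ : ℝ} (ha : 0 < a) (hb : 0 < b)
    (hS : 0 < sobolevConst Ω p) {f : EuclideanSpace ℝ (Fin N) → ℝ}
    (hfn : 0 < (eLpNorm f p.conjExponent (volume.restrict Ω)).toReal) (hp1 : 1 ≤ p)
    (hf : MemLp f p.conjExponent (volume.restrict Ω)) {w : H01 Ω}
    (hwp : MemLp (val w) p (volume.restrict Ω))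
    (hw : ⟪gradL Ω w, gradL Ω w⟫ = ∫ x in Ω, f x * val w x)
    (hμ : 0 < μ) (hμ' : μ < muStar Ω p a b f) :
    μ * ‖gradL Ω w‖ < a / 3 * √(2 * a / (3 * b)) := by
  have h1 := abs_integral_mul_val_le hp1 hf hwp
  have h2 := sobolevConst_mul_le (p := p) w
  rw [← hw, real_inner_self_eq_norm_sq, abs_of_nonneg (sq_nonneg _)] at h1
  unfold muStar at hμ'
  set S := sobolevConst Ω p
  set F := (eLpNorm f p.conjExponent (volume.restrict Ω)).toReal
  set P := (eLpNorm (val w) p (volume.restrict Ω)).toReal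
  set W := ‖gradL Ω w‖
  have hP : 0 ≤ P := ENNReal.toReal_nonneg
  have hW : 0 ≤ W := norm_nonneg _
  have hSs : 0 < √S := Real.sqrt_pos.2 hS
  have h3 : √S * P ≤ W := by
    refine abs_le_of_sq_le_sq' ?_ hW |>.2
    rwa [mul_pow, Real.sq_sqrt hS.le]
  have h4 : √S * W ≤ F := by
    rcases hW.eq_or_lt with h0 | h0
    · rw [← h0, mul_zero]; exact hfn.le
    · refine le_of_mul_le_mul_right ?_ h0
      nlinarith
  rw [lt_div_iff₀ hfn, Real.sqrt_mul (by positivity)] at hμ'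
  have h5 : μ * W < a / (18 * b) * √(6 * a * b) := by
    refine lt_of_mul_lt_mul_right ?_ hSs.le
    nlinarith
  have h6 : √(6 * a * b) ≤ 6 * b * √(2 * a / (3 * b)) := by
    rw [Real.sqrt_le_left (by positivity), mul_pow, Real.sq_sqrt (by positivity)]
    have : (6 * b) ^ 2 * (2 * a / (3 * b)) = 24 * a * b := by field_simp; ring
    rw [this]
    nlinarith [mul_pos ha hb]
  refine h5.trans_le ?_
  calc a / (18 * b) * √(6 * a * b) ≤ a / (18 * b) * (6 * b * √(2 * a / (3 * b))) := by gcongr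
    _ = a / 3 * √(2 * a / (3 * b)) := by field_simp; ring

lemma IsPositive.smul {w : H01 Ω} (hw : IsPositive w) {c : ℝ} (hc : 0 < c) :
    IsPositive (c • w) := by
  filter_upwards [hw, val_smul c w] with x h1 h2
  rw [h2, Pi.smul_apply, smul_eq_mul]
  exact mul_pos hc h1

end Riesz

/-! ### The two solutions -/

section MountainPass

variable {N : ℕ} {Ω : Set (EuclideanSpace ℝ (Fin N))} {a b μ : ℝ}
  {f : EuclideanSpace ℝ (Fin N) → ℝ} {w : H01 Ω}

lemma energy_eq_quarticEnergy
    (hw : ∀ v : H01 Ω, ⟪gradL Ω w, gradL Ω v⟫ = ∫ x in Ω, f x * val v x) :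
    energy a b μ f = quarticEnergy (gradL Ω) a b μ w := by
  ext u
  rw [energy, quarticEnergy, energyNorm_eq, hw]

/-- The mountain pass level is the maximum of the energy along the ray through `w`. It is attained
by a path, so the infimum is a minimum. -/
lemma isMountainPassLevel (hD : Function.Injective (gradL Ω)) (ha : 0 < a) (hb : 0 < b)
    (hμ : 0 < μ) (hw0 : w ≠ 0) {z : H01 Ω} (hz : z ∉ Submodule.span ℝ {w}) {s₂ : ℝ}
    (hs₂ : 0 < s₂) (hr : 2 * a / (3 * b) < s₂ ^ 2)
    (h₂ : a * s₂ - b * s₂ ^ 3 = μ * ‖gradL Ω w‖) {e : H01 Ω}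
    (he : 2 * a / (3 * b) < ‖gradL Ω e‖ ^ 2) (hI : quarticEnergy (gradL Ω) a b μ w e ≤ 0) :
    IsMountainPassLevel (quarticEnergy (gradL Ω) a b μ w) e
      (fiberEnergy a b (μ * ‖gradL Ω w‖) s₂) := by
  have hc : Continuous (quarticEnergy (gradL Ω) a b μ w) := by
    unfold quarticEnergy
    fun_prop
  have hbdd : ∀ γ : ℝ → H01 Ω, ContDiffOn ℝ 1 γ (Icc 0 1) →
      BddAbove ((fun t => quarticEnergy (gradL Ω) a b μ w (γ t)) '' Icc 0 1) := fun γ hγ =>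
    isCompact_Icc.bddAbove_image (hc.comp_continuousOn hγ.continuousOn)
  have hlower : ∀ γ : ℝ → H01 Ω, ContDiffOn ℝ 1 γ (Icc 0 1) → γ 0 = 0 → γ 1 = e →
      fiberEnergy a b (μ * ‖gradL Ω w‖) s₂ ≤
        sSup ((fun t => quarticEnergy (gradL Ω) a b μ w (γ t)) '' Icc 0 1) := by
    intro γ hγ h0 h1
    obtain ⟨t, ht, hle⟩ := exists_fiberEnergy_le_of_path ha hb hμ hs₂ hr h₂ he hI
      hγ.continuousOn h0 h1
    exact hle.trans (le_csSup (hbdd γ hγ) ⟨t, ht, rfl⟩)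
  refine ⟨hbdd, IsLeast.isGLB ⟨?_, ?_⟩⟩
  · obtain ⟨γ, hγ, γ0, γ1, hle⟩ :=
      smoothlyJoinedIn_quarticEnergy hD ha hb hμ hw0 hz hs₂ hr h₂ he hI
    refine ⟨γ, hγ.contDiffOn, γ0 0 le_rfl, γ1 1 le_rfl, le_antisymm
      (hlower γ hγ.contDiffOn (γ0 0 le_rfl) (γ1 1 le_rfl)) (csSup_le ⟨_, 0, by simp, rfl⟩ ?_)⟩
    rintro _ ⟨t, -, rfl⟩
    exact hle t
  · rintro _ ⟨γ, hγ, h0, h1, rfl⟩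
    exact hlower γ hγ h0 h1

end MountainPass

end Kirchhoff

open Kirchhoff in
theorem theorem3p3 {N : ℕ} (hN : 1 ≤ N) (Ω : Set (EuclideanSpace ℝ (Fin N)))
    (hΩo : IsOpen Ω) (hΩc : IsConnected Ω) (hΩb : Bornology.IsBounded Ω)
    (p : ℝ≥0∞) (hp : IsSobolevExponent N p)
    (a b : ℝ) (ha : 0 < a) (hb : 0 < b)
    (f : EuclideanSpace ℝ (Fin N) → ℝ)
    (hf : MemLp f p.conjExponent (volume.restrict Ω))
    (hfpos : ∀ᵐ x ∂(volume.restrict Ω), 0 < f x) :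
    0 < muStar Ω p a b f ∧
    ∀ μ : ℝ, 0 < μ → μ < muStar Ω p a b f →
      ∃ u₁ u₂ : H01 Ω, u₁ ≠ u₂ ∧
        (IsWeakSolution a b μ f u₁ ∧ IsPositive u₁ ∧
          IsLocalMin (energy a b μ f) u₁ ∧
          IsMinOn (energy a b μ f) {u : H01 Ω | energyNorm u ≤ √(2 * a / (3 * b))} u₁ ∧
          energy a b μ f u₁ < 0 ∧
          energyNorm u₁ ^ 2 < a / (3 * b)) ∧
        (IsWeakSolution a b μ f u₂ ∧ IsPositive u₂ ∧
          (∀ e : H01 Ω, √(2 * a / (3 * b)) < energyNorm e → energy a b μ f e ≤ 0 →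
            IsMountainPassLevel (energy a b μ f) e (energy a b μ f u₂)) ∧
          0 < energy a b μ f u₂ ∧ energy a b μ f u₂ < a ^ 2 / (4 * b) ∧
          2 * a / (3 * b) < energyNorm u₂ ^ 2 ∧ energyNorm u₂ ^ 2 < a / b) := by
  have hne : Ω.Nonempty := hΩc.nonempty
  have hp1 := hp.one_le
  have hS := sobolevConst_pos hN hΩo hne hΩb hp
  have hfn := eLpNorm_conjExponent_pos hΩo hne hp1 hf hfpos
  obtain ⟨C, -, hsob⟩ := exists_sobolev hΩb hp
  have hfi : ∀ v : H01 Ω, IntegrableOn (fun x => f x * val v x) Ω := fun v =>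
    integrable_mul_val hp1 hf (hsob v).1
  refine ⟨by unfold muStar; positivity, fun μ hμ hμ' => ?_⟩
  obtain ⟨w, hw⟩ := exists_weak_poisson hN hΩb hp hf
  have hwpos : IsPositive w := isPositive_of_weak hΩo hΩb hfpos hfi fun v => by
    rw [integral_inner_grad, hw]
  obtain ⟨z, hz⟩ := exists_notMem_span_of_isPositive hN hΩo hne hwpos
  have hD := gradL_injective (Ω := Ω) hN hΩb
  have hw0 : w ≠ 0 := hwpos.ne_zero hΩo hne
  have hDw : gradL Ω w ≠ 0 := by rwa [ne_eq, map_eq_zero_iff _ hD]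
  have hW : 0 < ‖gradL Ω w‖ := norm_pos_iff.2 hDw
  have hκ := mul_norm_lt_of_lt_muStar ha hb hS hfn hp1 hf (hsob w).1 (hw w) hμ hμ'
  obtain ⟨s₁, s₂, hs₁, h12, hs₁', hs₂r, hs₂', h₁, h₂⟩ :=
    exists_fiber_critical_points ha hb (mul_pos hμ hW) hκ
  have hs₂ : 0 < s₂ := hs₁.trans h12
  have hrs₂ : √(2 * a / (3 * b)) < s₂ := (Real.sqrt_lt' hs₂).2 hs₂r
  have hs₁a : 3 * b * s₁ ^ 2 < a := by
    rw [lt_div_iff₀ (by positivity)] at hs₁'; linarith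
  have hs₂a : 2 * a < 3 * b * s₂ ^ 2 := by
    rw [div_lt_iff₀ (by positivity)] at hs₂r; linarith
  have hs₂b : b * s₂ ^ 2 < a := by
    rw [lt_div_iff₀ hb] at hs₂'; linarith
  have ray := fun {s : ℝ} (hs : 0 ≤ s) =>
    quarticEnergy_ray (D := gradL Ω) (a := a) (b := b) (μ := μ) (w := w) hDw hs
  -- Below the norm `s₂` the energy is at least its value at the first critical point.
  have hmin : ∀ u : H01 Ω, ‖gradL Ω u‖ ≤ s₂ →
      fiberEnergy a b (μ * ‖gradL Ω w‖) s₁ ≤ quarticEnergy (gradL Ω) a b μ w u := fun u hu =>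
    (fiberEnergy_min hb hs₁ h12 h₁ h₂ (norm_nonneg _) hu).trans (fiberEnergy_le_quarticEnergy hμ u)
  have weak : ∀ {s : ℝ}, 0 < s → a * s - b * s ^ 3 = μ * ‖gradL Ω w‖ →
      IsWeakSolution a b μ f ((s / ‖gradL Ω w‖) • w) := fun hs h v => by
    refine ⟨hfi v, ?_⟩
    rw [integral_norm_grad_sq, integral_inner_grad, ← hw v]
    exact quarticEnergy_critical hDw hs.le h v
  rw [energy_eq_quarticEnergy hw]
  refine ⟨(s₁ / ‖gradL Ω w‖) • w, (s₂ / ‖gradL Ω w‖) • w, fun h => h12.ne ?_,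
    ⟨weak hs₁ h₁, hwpos.smul (by positivity), ?_, fun u hu => ?_, ?_, ?_⟩,
    ⟨weak hs₂ h₂, hwpos.smul (by positivity), fun e he hI => ?_, ?_, ?_, ?_, ?_⟩⟩
  · rw [← (ray hs₁.le).1, h, (ray hs₂.le).1]
  · have hopen : IsOpen {u : H01 Ω | ‖gradL Ω u‖ < s₂} :=
      isOpen_lt (gradL Ω).continuous.norm continuous_const
    filter_upwards [hopen.mem_nhds (by rw [Set.mem_ofPred_eq, (ray hs₁.le).1]; exact h12)] with u hu
    rw [(ray hs₁.le).2]
    exact hmin u (le_of_lt hu)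
  · rw [Set.mem_ofPred_eq, energyNorm_eq] at hu
    rw [Set.mem_ofPred_eq, (ray hs₁.le).2]
    exact hmin u (hu.trans hrs₂.le)
  · rw [(ray hs₁.le).2, fiberEnergy_critical h₁]
    exact mul_neg_of_pos_of_neg (by positivity) (by linarith)
  · rwa [energyNorm_eq, (ray hs₁.le).1]
  · rw [(ray hs₂.le).2]
    rw [energyNorm_eq, Real.sqrt_lt (by positivity) (norm_nonneg _)] at he
    exact isMountainPassLevel hD ha hb hμ hw0 hz hs₂ hs₂r h₂ he hI
  · rw [(ray hs₂.le).2, fiberEnergy_critical h₂]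
    exact mul_pos (by positivity) (by linarith)
  · -- The value is `s² (3bs² - 2a) / 4`, which increases to `a² / (4b)`
    -- as `s²` increases to `a / b`.
    rw [(ray hs₂.le).2, fiberEnergy_critical h₂, lt_div_iff₀ (by positivity)]
    have h3 : b * s₂ ^ 2 * (3 * b * s₂ ^ 2 - 2 * a) < a * a :=
      mul_lt_mul'' hs₂b (by linarith) (by positivity) (by linarith)
    linarith
  · rwa [energyNorm_eq, (ray hs₂.le).1]
  · rwa [energyNorm_eq, (ray hs₂.le).1]
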